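/- Consider $n$ nodes, with IDs $1,\dots,n$, and one server. At each time step $t=0,1,\dots,T-1$ node $i$ observes a data item $d_i^t$ from a totally ordered universe $D$; the items $d_1^t,\dots,d_n^t$ are pairwise distinct, and an adversary changes the items of exactly $m$ nodes between any two consecutive time steps ($1\le m\le n$, $T\ge 1$). At each time step, after the items have been observed, a communication protocol with at most $R$ synchronous rounds takes place. In a round the server may broadcast one message to all nodes and may send a message to each of any set of nodes; then each node may send a message to the server. Every broadcast and every single message costs $1$; messages may carry arbitrary information. What a party does depends only on its own past (for a node: its ID, the items it has observed and the messages it has received) and on random bits, which may even be shared by all parties. A randomized algorithm tracks the minimum over $T$ time steps if, for every such input sequence, with probability $1$ the server outputs $\min_i d_i^t$ at the end of every time step $t<T$. There is a universal constant $c>0$ such that for all $n,m,T,R\in\mathbb N$ with $1\le m\le n$ and $T\ge1$ there is an $N\in\mathbb N$ for which the following holds. For every totally ordered universe $D$ with at least $N$ elements (in particular, for every infinite one), and for every randomized algorithm using at most $R$ rounds per time step that tracks the minimum over $T$ time steps for items from $D$, there is an input sequence with exactly $m$ changed items per step on which the expected total number of messages is at least $$c\,\bigl(\log n+T\log m\bigr).$$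 -/

import Mathlib

/-!
Distributed monitoring with a broadcast channel: `n` nodes and one server.  At every time step each
node observes its current data item; then node-server communication takes place in synchronous
rounds, after which the server outputs a data item.
-/

namespace DistMonitoring

/-- A deterministic protocol for `n` nodes with data items in `D`, messages in `M`, local node
states in `Q` and server states in `S`.  None of these types is restricted, so a message may carry
arbitrarily much information, and all parties may remember their whole past.  A node's behaviour
depends only on its ID, on the items it has observed and on what the server has sent to it. -/
structure Protocol (n : ℕ) (D M Q S : Type*) where
  /-- initial state of each node -/
  nodeInit : Fin n → Q
  /-- initial state of the server -/
  serverInit : S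
  /-- a node reads its own current data item at the beginning of a time step -/
  observe : Fin n → D → Q → Q
  /-- the message (if any) that the server broadcasts in this round -/
  broadcast : S → Option M
  /-- the message (if any) that the server sends to one particular node in this round -/
  unicast : S → Fin n → Option M
  /-- a node processes the broadcast and the single message (if any) addressed to it -/
  hear : Fin n → Option M → Option M → Q → Q
  /-- the message (if any) that a node sends to the server in this round -/
  reply : Fin n → Q → Option M
  /-- the server processes the messages that the nodes have sent in this round -/
  collect : (Fin n → Option M) → S → S
  /-- the server's output -/
  output : S → D

/-- A global configuration, with the number of messages exchanged so far. -/
structure Config (n : ℕ) (Q S : Type*) where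
  nodes : Fin n → Q
  server : S
  messages : ℕ

namespace Protocol

variable {n : ℕ} {D M Q S : Type*}

/-- The configuration before the first time step. -/
def init (P : Protocol n D M Q S) : Config n Q S where
  nodes := P.nodeInit
  server := P.serverInit
  messages := 0

/-- All nodes read their current data items, given by `d`. -/
def read (P : Protocol n D M Q S) (d : Fin n → D) (C : Config n Q S) : Config n Q S where
  nodes := fun i => P.observe i (d i) (C.nodes i)
  server := C.server
  messages := C.messages

/-- The node states in a round after the server's messages have been delivered. -/
def heard (P : Protocol n D M Q S) (C : Config n Q S) (i : Fin n) : Q :=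
  P.hear i (P.broadcast C.server) (P.unicast C.server i) (C.nodes i)

/-- The messages that the nodes send to the server in a round. -/
def replies (P : Protocol n D M Q S) (C : Config n Q S) (i : Fin n) : Option M :=
  P.reply i (P.heard C i)

/-- The number of messages of one round: a broadcast costs one, and so does every single message
from the server to a node or from a node to the server. -/
def roundCost (P : Protocol n D M Q S) (C : Config n Q S) : ℕ :=
  (if (P.broadcast C.server).isSome then 1 else 0)
    + (Finset.univ.filter fun i => (P.unicast C.server i).isSome).card
    + (Finset.univ.filter fun i => (P.replies C i).isSome).card

/-- One communication round: first the server sends, then the nodes send. -/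
def round (P : Protocol n D M Q S) (C : Config n Q S) : Config n Q S where
  nodes := P.heard C
  server := P.collect (P.replies C) C.server
  messages := C.messages + P.roundCost C

/-- `P.run R x t` is the configuration after the first `t` time steps (the time steps
`0, …, t - 1`), if node `i` observes `x s i` at time step `s` and every time step has `R`
communication rounds.  Rounds in which nothing is sent are free. -/
def run (P : Protocol n D M Q S) (R : ℕ) (x : ℕ → Fin n → D) : ℕ → Config n Q S
  | 0 => P.init
  | t + 1 => P.round^[R] (P.read (x t) (P.run R x t))

/-- At each of the time steps `0, …, T - 1` the server outputs the smallest current data item. -/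
def TracksMinOn [LinearOrder D] (P : Protocol n D M Q S) (R T : ℕ) (x : ℕ → Fin n → D) : Prop :=
  ∀ t < T, IsLeast (Set.range (x t)) (P.output (P.run R x (t + 1)).server)

end Protocol

/-- The inputs over `T` time steps with `m` updates per step: at every time step the `n` data items
are pairwise distinct, and exactly `m` nodes receive a new data item between consecutive steps. -/
def IsInput {n : ℕ} {D : Type*} [LinearOrder D] (m T : ℕ) (x : ℕ → Fin n → D) : Prop :=
  (∀ t < T, Function.Injective (x t)) ∧
    ∀ t, t + 1 < T → (Finset.univ.filter fun i => x (t + 1) i ≠ x t i).card = m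

end DistMonitoring

/-! By Yao's averaging argument it suffices to find one finite distribution of inputs on which every
deterministic protocol that is correct on all inputs considered sends many messages on average. Let
the nodes `0, …, m - 1` change in every step, and call a pair (time, node) at which a new item
appears a slot. The distribution `law` fills the slots in order of time, and in random order within
a time step, with ever smaller values. So each new item lies below all items from earlier times, and
the minimum is always an item just observed.

The core (`slot_bound`) is that, while `k` slots of the current time are open, the node filled next,
which gets the largest of the `k` items, sends a message with probability at least `1 / (8 k)`. The
fixed items being given, let the server ignore the replies of these `k` nodes. Then the first round
in which such a node replies depends on its own item only, and if none replies, the output is a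
fixed item, which is rarely correct. Pretend that every item is a uniform leaf below the chosen
vertex `W`. The expected number of nodes replying before round `τ` rises from `0` to nearly `1` or
more, so it crosses `1/2` at some `τ`. A node that replies by round `τ` while no other replies
before `τ` does so in the true execution as well; by a union bound its competitors stay silent with
probability at least `1/2`. Only the marginals of their items matter. Summing over all slots gives
`1/8` of `H_n + (T - 1) H_m`.

It remains to hide from a node whether its item is the largest. The largest item lies below the
right child of `W` and the others below the left child, but `W` sits at a random height. By an
energy argument (`sum_osc_le`), at most heights a bounded function on the leaves has nearly equal
averages over `W` and over its descendants a fixed number of levels down. The value of each slot has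
bounded density with respect to the uniform distribution on those descendants (`abs_law_sub_le`), so
it looks like a uniform leaf below `W`. Finitely many functions have to be fooled, their number
depending on `n, m, T, R`, so a tree of bounded height suffices. -/

namespace DistMonitoring

/-! ### Finitely supported expectations as functionals -/

/-- `Φ` is a finite convex combination of evaluations at points of `S`. -/
def IsMean {X : Type*} (S : Set X) (Φ : (X → ℝ) → ℝ) : Prop :=
  ∃ (κ : Type) (_ : Fintype κ) (c : κ → ℝ) (pt : κ → X), (∀ k, 0 ≤ c k) ∧ ∑ k, c k = 1 ∧
    (∀ k, pt k ∈ S) ∧ ∀ F, Φ F = ∑ k, c k * F (pt k)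

namespace IsMean

variable {X : Type*} {S : Set X} {Φ : (X → ℝ) → ℝ}

theorem dirac {x : X} (hx : x ∈ S) : IsMean S (fun F => F x) :=
  ⟨Unit, inferInstance, fun _ => 1, fun _ => x, by simp, by simp, by simpa using hx, by simp⟩

theorem superset {S' : Set X} (h : IsMean S Φ) (hS : S ⊆ S') : IsMean S' Φ := by
  obtain ⟨κ, _, c, pt, h0, h1, h2, h3⟩ := h
  exact ⟨κ, inferInstance, c, pt, h0, h1, fun k => hS (h2 k), h3⟩

theorem combine {ι : Type} (s : Finset ι) (c : ι → ℝ) (Ψ : ι → (X → ℝ) → ℝ)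
    (hc : ∀ i ∈ s, 0 ≤ c i) (hs : ∑ i ∈ s, c i = 1) (h : ∀ i ∈ s, IsMean S (Ψ i)) :
    IsMean S (fun F => ∑ i ∈ s, c i * Ψ i F) := by
  have h' : ∀ i : s, IsMean S (Ψ i) := fun i => h i i.2
  choose κ hκ b pt h0 h1 h2 h3 using h'
  refine ⟨(i : s) × κ i, inferInstance, fun k => c k.1 * b k.1 k.2, fun k => pt k.1 k.2,
    fun k => mul_nonneg (hc _ k.1.2) (h0 _ _), ?_, fun k => h2 _ _, fun F => ?_⟩
  · rw [Fintype.sum_sigma]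
    simp only [← Finset.mul_sum, h1, mul_one]
    exact (Finset.sum_coe_sort s c).trans hs
  · rw [Fintype.sum_sigma]
    refine (Finset.sum_coe_sort s fun i => c i * Ψ i F).symm.trans ?_
    refine Finset.sum_congr rfl fun i _ => ?_
    rw [h3, Finset.mul_sum]
    exact Finset.sum_congr rfl fun k _ => by ring

theorem average {ι : Type} (s : Finset ι) (hs : s.Nonempty) (Ψ : ι → (X → ℝ) → ℝ)
    (h : ∀ i ∈ s, IsMean S (Ψ i)) : IsMean S (fun F => (∑ i ∈ s, Ψ i F) / s.card) := by
  have hs' : (s.card : ℝ) ≠ 0 := by exact_mod_cast hs.card_pos.ne'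
  have := combine s (fun _ => (s.card : ℝ)⁻¹) Ψ (fun _ _ => by positivity)
    (by simp [hs']) h
  simpa only [← Finset.mul_sum, div_eq_inv_mul] using this

theorem add (h : IsMean S Φ) (F G : X → ℝ) : Φ (fun x => F x + G x) = Φ F + Φ G := by
  obtain ⟨κ, _, c, pt, h0, h1, h2, h3⟩ := h
  simp only [h3, mul_add, Finset.sum_add_distrib]

theorem sub (h : IsMean S Φ) (F G : X → ℝ) : Φ (fun x => F x - G x) = Φ F - Φ G := by
  obtain ⟨κ, _, c, pt, h0, h1, h2, h3⟩ := h
  simp only [h3, mul_sub, Finset.sum_sub_distrib]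

theorem const_mul (h : IsMean S Φ) (r : ℝ) (F : X → ℝ) : Φ (fun x => r * F x) = r * Φ F := by
  obtain ⟨κ, _, c, pt, h0, h1, h2, h3⟩ := h
  simp only [h3, Finset.mul_sum]
  exact Finset.sum_congr rfl fun k _ => by ring

theorem const (h : IsMean S Φ) (r : ℝ) : Φ (fun _ => r) = r := by
  obtain ⟨κ, _, c, pt, h0, h1, h2, h3⟩ := h
  simp only [h3, ← Finset.sum_mul, h1, one_mul]

theorem sum (h : IsMean S Φ) {ι : Type*} (s : Finset ι) (F : ι → X → ℝ) :
    Φ (fun x => ∑ i ∈ s, F i x) = ∑ i ∈ s, Φ (F i) := by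
  obtain ⟨κ, _, c, pt, h0, h1, h2, h3⟩ := h
  simp only [h3, Finset.mul_sum]
  exact Finset.sum_comm

theorem mono (h : IsMean S Φ) {F G : X → ℝ} (hFG : ∀ x ∈ S, F x ≤ G x) : Φ F ≤ Φ G := by
  obtain ⟨κ, _, c, pt, h0, h1, h2, h3⟩ := h
  simp only [h3]
  exact Finset.sum_le_sum fun k _ => mul_le_mul_of_nonneg_left (hFG _ (h2 k)) (h0 k)

theorem congr (h : IsMean S Φ) {F G : X → ℝ} (hFG : ∀ x ∈ S, F x = G x) : Φ F = Φ G :=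
  le_antisymm (h.mono fun x hx => (hFG x hx).le) (h.mono fun x hx => (hFG x hx).ge)

theorem abs_sub_le (h : IsMean S Φ) (F : X → ℝ) (r : ℝ) :
    |Φ F - r| ≤ Φ (fun x => |F x - r|) := by
  have e : Φ F - r = Φ (fun x => F x - r) := by rw [h.sub, h.const]
  rw [e, abs_le]
  constructor
  · have := h.mono (F := fun x => (-1) * |F x - r|) (G := fun x => F x - r)
      (fun x _ => by linarith [neg_abs_le (F x - r)])
    rw [h.const_mul] at this
    linarith
  · exact h.mono fun x _ => le_abs_self _

theorem exists_le (h : IsMean S Φ) (F : X → ℝ) : ∃ x ∈ S, Φ F ≤ F x := by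
  by_contra! hlt
  obtain ⟨κ, _, c, pt, h0, h1, h2, h3⟩ := h
  have e : ∑ k, c k * F (pt k) < ∑ k, c k * Φ F := by
    refine Finset.sum_lt_sum
      (fun k _ => mul_le_mul_of_nonneg_left (hlt _ (h2 k)).le (h0 k)) ?_
    by_contra! hle
    have : ∀ k ∈ Finset.univ, c k = 0 := fun k hk => by
      by_contra hne
      have := mul_lt_mul_of_pos_left (hlt _ (h2 k)) (lt_of_le_of_ne (h0 k) (Ne.symm hne))
      exact absurd (hle k hk) (not_le.2 this)
    rw [Finset.sum_eq_zero this] at h1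
    exact zero_ne_one h1
  rw [← Finset.sum_mul, h1, one_mul, ← h3] at e
  exact lt_irrefl _ e

/-- The exchange of the random input with the random bits in Yao's argument. -/
theorem integral (h : IsMean S Φ) {Ω : Type*} [MeasurableSpace Ω] (μ : MeasureTheory.Measure Ω)
    (f : X → Ω → ℝ) (hf : ∀ x, MeasureTheory.Integrable (f x) μ) :
    MeasureTheory.Integrable (fun ω => Φ (fun x => f x ω)) μ ∧
      Φ (fun x => ∫ ω, f x ω ∂μ) = ∫ ω, Φ (fun x => f x ω) ∂μ := by
  obtain ⟨κ, _, c, pt, h0, h1, h2, h3⟩ := h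
  simp only [h3]
  constructor
  · exact MeasureTheory.integrable_finsetSum _ fun k _ => (hf _).const_mul _
  · rw [MeasureTheory.integral_finsetSum _ fun k _ => (hf _).const_mul _]
    simp only [MeasureTheory.integral_const_mul]

end IsMean

/-! ### Averages over subtrees of the binary tree -/

/-- In the infinite binary tree whose vertices at each height are numbered from left to right, the
children of `w` are `2 * w` and `2 * w + 1`: `halve` averages a function over the children. -/
noncomputable def halve (g : ℕ → ℝ) (w : ℕ) : ℝ := (g (2 * w) + g (2 * w + 1)) / 2

/-- The descendants of `w` that lie `a` levels below. -/
def cell (a w : ℕ) : Set ℕ := {z | z / 2 ^ a = w}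

theorem mem_cell_add {a b v w z : ℕ} (hz : z ∈ cell b v) (hv : v ∈ cell a w) :
    z ∈ cell (a + b) w := by
  simp only [cell, Set.mem_ofPred_eq] at *
  rw [add_comm, pow_add, ← Nat.div_div_eq_div_mul, hz, hv]

theorem left_mem_cell (w : ℕ) : 2 * w ∈ cell 1 w := by
  simp [cell]

theorem right_mem_cell (w : ℕ) : 2 * w + 1 ∈ cell 1 w := by
  simp only [cell, Set.mem_ofPred_eq]; omega

theorem halve_iterate_succ (a : ℕ) (g : ℕ → ℝ) (w : ℕ) :
    halve^[a + 1] g w = (halve^[a] g (2 * w) + halve^[a] g (2 * w + 1)) / 2 := by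
  rw [Function.iterate_succ_apply']; rfl

theorem IsMean.halve_iterate {X : Type*} {S : Set X} (Ψ : ℕ → (X → ℝ) → ℝ) (a : ℕ) :
    ∀ w : ℕ, (∀ z ∈ cell a w, IsMean S (Ψ z)) →
      IsMean S (fun F => halve^[a] (fun z => Ψ z F) w) := by
  induction a with
  | zero => exact fun w h => h w (by simp [cell])
  | succ a ih =>
    intro w h
    have h0 := ih (2 * w) fun z hz => h z (by
      simpa [add_comm] using mem_cell_add hz (left_mem_cell w))
    have h1 := ih (2 * w + 1) fun z hz => h z (by
      simpa [add_comm] using mem_cell_add hz (right_mem_cell w))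
    have := IsMean.combine (S := S) (Finset.univ : Finset Bool) (fun _ => 1 / 2)
      (fun b F => halve^[a] (fun z => Ψ z F) (if b then 2 * w else 2 * w + 1))
      (fun _ _ => by norm_num) (by simp) (fun b _ => by cases b <;> simpa)
    convert this using 2 with F
    rw [halve_iterate_succ]
    simp
    ring

theorem isMean_halve (a w : ℕ) : IsMean (cell a w) (fun F => halve^[a] F w) :=
  IsMean.halve_iterate (fun z F => F z) a w fun _ hz => IsMean.dirac hz

theorem halve_iterate_mono {a w : ℕ} {F G : ℕ → ℝ} (h : ∀ z ∈ cell a w, F z ≤ G z) :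
    halve^[a] F w ≤ halve^[a] G w := (isMean_halve a w).mono h

theorem halve_iterate_add (a b : ℕ) (g : ℕ → ℝ) : halve^[a + b] g = halve^[a] (halve^[b] g) :=
  Function.iterate_add_apply _ _ _ _

/-- Conditioning on one of two equally likely children at most doubles the mean of a nonnegative
function. This is the only source of the powers of 2 below. -/
theorem child_le_halve (a : ℕ) {g : ℕ → ℝ} (hg : ∀ z, 0 ≤ g z) (w : ℕ) :
    halve^[a] g (2 * w) ≤ 2 * halve^[a + 1] g w ∧
      halve^[a] g (2 * w + 1) ≤ 2 * halve^[a + 1] g w := by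
  have h : ∀ v, 0 ≤ halve^[a] g v := fun v => by
    have := (isMean_halve a v).mono (F := fun _ => 0) (G := g) fun z _ => hg z
    rwa [(isMean_halve a v).const] at this
  rw [halve_iterate_succ]
  constructor <;> linarith [h (2 * w), h (2 * w + 1)]

/-! ### Oscillation and the energy argument -/

/-- The oscillation of the averages of `g`, over the vertices `d` levels below the vertex `w` of
height `h`. -/
noncomputable def osc (g : ℕ → ℝ) (d h w : ℕ) : ℝ :=
  halve^[d] (fun v => |halve^[h - d] g v - halve^[h] g w|) w

theorem osc_nonneg (g : ℕ → ℝ) (d h w : ℕ) : 0 ≤ osc g d h w := by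
  have := (isMean_halve d w).mono (F := fun _ => 0)
    (G := fun v => |halve^[h - d] g v - halve^[h] g w|) fun z _ => abs_nonneg _
  rwa [(isMean_halve d w).const] at this

/-- Apply `|x| ≤ δ / 2 + x ^ 2 / (2 * δ)` to the deviation from the mean. The mean square deviation
is the variance, which is the gain of energy over `d` levels. -/
theorem osc_le (g : ℕ → ℝ) {d h : ℕ} (hd : d ≤ h) (w : ℕ) {δ : ℝ} (hδ : 0 < δ) :
    osc g d h w ≤ δ / 2 +
      (halve^[d] (fun v => (halve^[h - d] g v) ^ 2) w - (halve^[h] g w) ^ 2) / (2 * δ) := by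
  have M := isMean_halve d w
  set r := halve^[h] g w with hr
  have hr' : halve^[d] (halve^[h - d] g) w = r := by
    rw [← halve_iterate_add, Nat.add_sub_cancel' hd]
  have e : halve^[d] (fun v => δ / 2 + ((halve^[h - d] g v) ^ 2 -
      (2 * r) * halve^[h - d] g v + r ^ 2) * (1 / (2 * δ))) w
      = δ / 2 + (halve^[d] (fun v => (halve^[h - d] g v) ^ 2) w - r ^ 2) / (2 * δ) := by
    simp only [mul_comm _ (1 / (2 * δ))]
    rw [M.add, M.const, M.const_mul, M.add, M.sub, M.const_mul, M.const, hr']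
    ring
  rw [← e]
  refine M.mono fun v _ => ?_
  set u := halve^[h - d] g v
  have : δ / 2 + (u ^ 2 - 2 * r * u + r ^ 2) * (1 / (2 * δ)) - |u - r|
      = (|u - r| - δ) ^ 2 / (2 * δ) := by
    rw [sub_sq, sq_abs]; field_simp; ring
  have h2 : 0 ≤ (|u - r| - δ) ^ 2 / (2 * δ) := by positivity
  linarith

theorem halve_iterate_mem_Icc {g : ℕ → ℝ} (h0 : ∀ z, 0 ≤ g z) (h1 : ∀ z, g z ≤ 1) (a w : ℕ) :
    0 ≤ halve^[a] g w ∧ halve^[a] g w ≤ 1 := by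
  have M := isMean_halve a w
  have e0 := M.mono (F := fun _ => 0) (G := g) fun z _ => h0 z
  have e1 := M.mono (F := g) (G := fun _ => 1) fun z _ => h1 z
  rw [M.const] at e0 e1
  exact ⟨e0, e1⟩

/-- The sum telescopes with stride `d`, so only `d` terms at each end survive. -/
theorem sum_shift_sub_le (e : ℕ → ℝ) (h0 : ∀ a, 0 ≤ e a) (h1 : ∀ a, e a ≤ 1) (d L : ℕ) :
    ∑ a ∈ Finset.range L, (e (a + d) - e a) ≤ d := by
  have key : ∀ L, ∑ a ∈ Finset.range L, (e (a + d) - e a)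
      = ∑ b ∈ Finset.range d, (e (L + b) - e b) := by
    intro L
    induction L with
    | zero => simp
    | succ L ih =>
      rw [Finset.sum_range_succ, ih]
      have h := Finset.sum_range_succ (fun b => e (L + b)) d
      rw [Finset.sum_range_succ'] at h
      simp only [Finset.sum_sub_distrib]
      have h' : ∑ b ∈ Finset.range d, e (L + 1 + b) = ∑ b ∈ Finset.range d, e (L + (b + 1)) :=
        Finset.sum_congr rfl fun b _ => by congr 1; ring
      rw [h']
      simp only [add_zero] at h
      linarith
  rw [key]
  calc _ ≤ ∑ b ∈ Finset.range d, (1 : ℝ) :=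
        Finset.sum_le_sum fun b _ => by linarith [h1 (L + b), h0 b]
    _ = d := by simp

/-- At most heights, averages over subtrees do not oscillate. -/
theorem sum_osc_le {g : ℕ → ℝ} (h0 : ∀ z, 0 ≤ g z) (h1 : ∀ z, g z ≤ 1) {d L ℓ : ℕ}
    (hℓ : L + d ≤ ℓ) (w : ℕ) {δ : ℝ} (hδ : 0 < δ) :
    ∑ a ∈ Finset.range L, halve^[a] (osc g d (ℓ - a)) w ≤ L * (δ / 2) + d / (2 * δ) := by
  -- The energy at depth `a`: the mean square of the averages over the subtrees rooted there.
  set e : ℕ → ℝ := fun a => halve^[a] (fun v => (halve^[ℓ - a] g v) ^ 2) w with he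
  have hI : ∀ a v, 0 ≤ (halve^[ℓ - a] g v) ^ 2 ∧ (halve^[ℓ - a] g v) ^ 2 ≤ 1 := fun a v => by
    obtain ⟨i0, i1⟩ := halve_iterate_mem_Icc h0 h1 (ℓ - a) v
    exact ⟨by positivity, pow_le_one₀ i0 i1⟩
  have he0 : ∀ a, 0 ≤ e a := fun a =>
    (halve_iterate_mem_Icc (fun v => (hI a v).1) (fun v => (hI a v).2) a w).1
  have he1 : ∀ a, e a ≤ 1 := fun a =>
    (halve_iterate_mem_Icc (fun v => (hI a v).1) (fun v => (hI a v).2) a w).2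
  have step : ∀ a ∈ Finset.range L,
      halve^[a] (osc g d (ℓ - a)) w ≤ δ / 2 + (2 * δ)⁻¹ * (e (a + d) - e a) := by
    intro a ha
    have ha' := Finset.mem_range.1 ha
    have M := isMean_halve a w
    refine (M.mono fun v _ => osc_le g (d := d) (h := ℓ - a) (by omega) v hδ).trans ?_
    simp only [div_eq_inv_mul _ (2 * δ)]
    rw [M.add, M.const, M.const_mul, M.sub, ← halve_iterate_add]
    rw [show ℓ - a - d = ℓ - (a + d) by omega]
  refine (Finset.sum_le_sum step).trans ?_
  rw [Finset.sum_add_distrib, ← Finset.mul_sum]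
  have := sum_shift_sub_le e he0 he1 d L
  have h2 := mul_le_mul_of_nonneg_left this (by positivity : 0 ≤ (2 * δ)⁻¹)
  simp only [Finset.sum_const, Finset.card_range, nsmul_eq_mul]
  calc _ ≤ L * (δ / 2) + (2 * δ)⁻¹ * d := by linarith
    _ = _ := by ring

/-! ### The hard distribution -/

section Law

variable {ι : Type} [DecidableEq ι]

/-- The expectation with respect to the following random way of giving values to the `p` elements
of `A`, in decreasing order and all below the vertex `w` of height `ℓ`.  A random element of `cur A`
gets the value of a random leaf below the right child of a random vertex `W` at a random height, and
the other elements of `A` get values below the left child of `W`. -/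
noncomputable def law (cur : Finset ι → Finset ι) (L : ℕ → ℕ) :
    ℕ → ℕ → ℕ → Finset ι → (ι → ℕ) → ((ι → ℕ) → ℝ) → ℝ
  | 0, _, _, _, y, F => F y
  | p + 1, ℓ, w, A, y, F =>
    (∑ I ∈ cur A, (∑ a ∈ Finset.range (L p), halve^[a] (fun W => halve^[ℓ - a - 1] (fun z =>
      law cur L p (ℓ - a - 1) (2 * W) (A.erase I) (Function.update y I z) F) (2 * W + 1)) w)
        / (Finset.range (L p)).card) / (cur A).card

/-- The extensions of `y` by distinct values below the vertex `w` of height `ℓ`. -/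
def extensions (ℓ w : ℕ) (A : Finset ι) (y : ι → ℕ) : Set (ι → ℕ) :=
  {y' | (∀ j, j ∉ A → y' j = y j) ∧ Set.InjOn y' A ∧ ∀ j ∈ A, y' j ∈ cell ℓ w}

theorem extensions_step {ℓ w : ℕ} {A : Finset ι} {y : ι → ℕ} {I : ι} (hI : I ∈ A) {a W z : ℕ}
    (ha : a + 1 ≤ ℓ) (hW : W ∈ cell a w) (hz : z ∈ cell (ℓ - a - 1) (2 * W + 1)) :
    extensions (ℓ - a - 1) (2 * W) (A.erase I) (Function.update y I z) ⊆ extensions ℓ w A y := by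
  rintro y' ⟨h1, h2, h3⟩
  have hyI : y' I = z := by rw [h1 I (by simp)]; simp
  have up : ∀ {v u}, v ∈ cell 1 W → u ∈ cell (ℓ - a - 1) v → u ∈ cell ℓ w := by
    intro v u hv hu
    have := mem_cell_add (mem_cell_add hu hv) hW
    rwa [show a + (1 + (ℓ - a - 1)) = ℓ by omega] at this
  have hne : ∀ j ∈ A.erase I, y' j ≠ z := by
    intro j hj h
    have h4 := h3 j hj
    simp only [cell, Set.mem_ofPred_eq] at hz h4
    rw [h, hz] at h4
    omega
  refine ⟨fun j hj => ?_, ?_, fun j hj => ?_⟩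
  · have : j ≠ I := fun h => hj (h ▸ hI)
    rw [h1 j (by simp [hj]), Function.update_of_ne this]
  · intro i hi j hj hij
    by_cases hiI : i = I
    · by_cases hjI : j = I
      · rw [hiI, hjI]
      · exact absurd (hij ▸ hiI ▸ hyI : y' j = z) (hne j (by simp [hjI]; exact hj))
    · by_cases hjI : j = I
      · exact absurd (hij.trans (hjI ▸ hyI)) (hne i (by simp [hiI]; exact hi))
      · exact h2 (by simp [hiI]; exact hi) (by simp [hjI]; exact hj) hij
  · by_cases hjI : j = I
    · rw [hjI, hyI]; exact up (right_mem_cell W) hz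
    · exact up (left_mem_cell W) (h3 j (by simp [hjI, hj]))

variable {cur : Finset ι → Finset ι} {L U : ℕ → ℕ}

/-- Choosing a height costs at most `L p` levels, including the descent to a child, and `U p` levels
remain for the other `p` elements. Hence the recursion for `U`. -/
theorem isMean_law (hsub : ∀ A, cur A ⊆ A) (hne : ∀ A : Finset ι, A.Nonempty → (cur A).Nonempty)
    (hL : ∀ p, 0 < L p) (hU : ∀ p, U (p + 1) = U p + L p) (p : ℕ) :
    ∀ (ℓ w : ℕ) (A : Finset ι) (y : ι → ℕ), A.card = p → U p ≤ ℓ →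
      IsMean (extensions ℓ w A y) (law cur L p ℓ w A y) := by
  induction p with
  | zero =>
    intro ℓ w A y hA _
    rw [Finset.card_eq_zero] at hA
    subst hA
    exact IsMean.dirac ⟨by simp, by simp, by simp⟩
  | succ p ih =>
    intro ℓ w A y hA hℓ
    rw [hU] at hℓ
    have hA' : A.Nonempty := Finset.card_pos.1 (by omega)
    refine IsMean.average _ (hne A hA') _ fun I hI => ?_
    refine IsMean.average _ (by simpa using (hL p).ne') _ fun a ha => ?_
    rw [Finset.mem_range] at ha
    refine IsMean.halve_iterate _ a w fun W hW => ?_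
    refine IsMean.halve_iterate _ _ _ fun z hz => ?_
    refine IsMean.superset (ih _ _ _ _ ?_ (by omega))
      (extensions_step (hsub _ hI) (by omega) hW hz)
    rw [Finset.card_erase_of_mem (hsub _ hI), hA]; rfl

/-- The value of each single element is distributed almost as a random leaf, as far as `g` can
tell from the averages at height `c`. -/
theorem abs_law_sub_le (hsub : ∀ A, cur A ⊆ A)
    (hne : ∀ A : Finset ι, A.Nonempty → (cur A).Nonempty)
    (hL : ∀ p, 0 < L p) (hU : ∀ p, U (p + 1) = U p + L p) (g : ℕ → ℝ) (r : ℝ) (c : ℕ) (j : ι)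
    (p : ℕ) : ∀ (ℓ w : ℕ) (A : Finset ι) (y : ι → ℕ), A.card = p → c + U p ≤ ℓ → j ∈ A →
      |law cur L p ℓ w A y (fun y' => g (y' j)) - r| ≤
        2 ^ p * halve^[ℓ - c] (fun v => |halve^[c] g v - r|) w := by
  induction p with
  | zero =>
    intro ℓ w A y hA _ hj
    rw [Finset.card_eq_zero] at hA
    subst hA
    simp at hj
  | succ p ih =>
    intro ℓ w A y hA hℓ hj
    rw [hU] at hℓ
    set φ : ℕ → ℝ := fun v => |halve^[c] g v - r| with hφ
    have hφ0 : ∀ v, 0 ≤ φ v := fun v => abs_nonneg _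
    -- Whether `j` is the chosen element or not, its value lies below one child of `W`. That descent
    -- costs the one new factor 2; averaging over `W` afterwards costs nothing.
    have step : ∀ I ∈ cur A, ∀ a ∈ Finset.range (L p), ∀ W : ℕ,
        |halve^[ℓ - a - 1] (fun z => law cur L p (ℓ - a - 1) (2 * W) (A.erase I)
          (Function.update y I z) (fun y' => g (y' j))) (2 * W + 1) - r|
        ≤ 2 ^ (p + 1) * halve^[ℓ - c - a] φ W := by
      intro I hI a ha W
      rw [Finset.mem_range] at ha
      have hcard : (A.erase I).card = p := by
        rw [Finset.card_erase_of_mem (hsub _ hI), hA]; rfl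
      have hC := child_le_halve (ℓ - a - 1 - c) hφ0 W
      rw [show ℓ - a - 1 - c + 1 = ℓ - c - a by omega] at hC
      have M := isMean_halve (ℓ - a - 1) (2 * W + 1)
      by_cases hIj : I = j
      · have e : ∀ z, law cur L p (ℓ - a - 1) (2 * W) (A.erase I)
            (Function.update y I z) (fun y' => g (y' j)) = g z := by
          intro z
          have M' := isMean_law hsub hne hL hU p (ℓ - a - 1) (2 * W) (A.erase I)
            (Function.update y I z) hcard (by omega)
          rw [M'.congr (G := fun _ => g z), M'.const]
          rintro y' ⟨h1, -, -⟩
          rw [h1 j (by simp [hIj]), hIj]; simp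
        simp only [e]
        rw [show ℓ - a - 1 = (ℓ - a - 1 - c) + c by omega, halve_iterate_add]
        refine ((isMean_halve _ _).abs_sub_le _ _).trans (hC.2.trans ?_)
        have h0 := (halve_iterate_mono (a := ℓ - c - a) (w := W) (F := fun _ => 0) (G := φ)
          fun z _ => hφ0 z)
        rw [(isMean_halve _ _).const] at h0
        have : (1 : ℝ) ≤ 2 ^ p := one_le_pow₀ (by norm_num)
        rw [pow_succ]
        nlinarith
      · refine (M.abs_sub_le _ _).trans ?_
        rw [← M.const (2 ^ (p + 1) * halve^[ℓ - c - a] φ W)]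
        refine M.mono fun z _ => ?_
        refine (ih _ _ _ _ hcard (by omega) (by simp [Ne.symm hIj, hj])).trans ?_
        rw [pow_succ, mul_assoc]
        exact mul_le_mul_of_nonneg_left hC.1 (by positivity)
    have hcur : (cur A).Nonempty := hne A ⟨j, hj⟩
    set Ψ : ι → ℕ → ℕ → ℝ := fun I a W =>
      halve^[ℓ - a - 1] (fun z => law cur L p (ℓ - a - 1) (2 * W) (A.erase I)
          (Function.update y I z) (fun y' => g (y' j))) (2 * W + 1) with hΨ
    have M1 : IsMean (Set.univ : Set (ι × ℕ × ℕ)) (fun F => (∑ I ∈ cur A,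
        (∑ a ∈ Finset.range (L p), halve^[a] (fun W => F (I, a, W)) w)
          / (Finset.range (L p)).card) / (cur A).card) := by
      refine IsMean.average _ hcur _ fun I hI => ?_
      refine IsMean.average _ (by simpa using (hL p).ne') _ fun a ha => ?_
      exact IsMean.halve_iterate _ a w fun W hW => IsMean.dirac (Set.mem_univ _)
    have h3 := M1.abs_sub_le (fun x => Ψ x.1 x.2.1 x.2.2) r
    refine h3.trans ?_
    have hcR : ((cur A).card : ℝ) ≠ 0 := by exact_mod_cast hcur.card_pos.ne'
    have hLR : (L p : ℝ) ≠ 0 := by exact_mod_cast (hL p).ne'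
    have bound : ∀ I ∈ cur A, ∀ a ∈ Finset.range (L p), halve^[a] (fun W => |Ψ I a W - r|) w ≤
        2 ^ (p + 1) * halve^[ℓ - c] φ w := by
      intro I hI a ha
      refine ((isMean_halve a w).mono fun W _ => step I hI a ha W).trans ?_
      rw [Finset.mem_range] at ha
      rw [(isMean_halve a w).const_mul, ← halve_iterate_add,
        show a + (ℓ - c - a) = ℓ - c by omega]
    rw [div_le_iff₀ (by positivity)]
    refine (Finset.sum_le_card_nsmul _ _ (2 ^ (p + 1) * halve^[ℓ - c] φ w) fun I hI => ?_).trans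
      (by rw [nsmul_eq_mul, mul_comm])
    rw [Finset.card_range, div_le_iff₀ (by positivity)]
    refine (Finset.sum_le_card_nsmul _ _ _ (bound I hI)).trans ?_
    rw [nsmul_eq_mul, Finset.card_range, mul_comm]

end Law

/-! ### The probability that the next node speaks -/

/-- The indicator function of a property of numbers. -/
noncomputable def indic (s : ℕ → Prop) (z : ℕ) : ℝ := by
  classical exact if s z then 1 else 0

theorem indic_nonneg (s : ℕ → Prop) (z : ℕ) : 0 ≤ indic s z := by
  unfold indic; split_ifs <;> norm_num

theorem indic_le_one (s : ℕ → Prop) (z : ℕ) : indic s z ≤ 1 := by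
  unfold indic; split_ifs <;> norm_num

theorem indic_of_true {s : ℕ → Prop} {z : ℕ} (h : s z) : indic s z = 1 := by
  simp [indic, h]

theorem indic_of_false {s : ℕ → Prop} {z : ℕ} (h : ¬ s z) : indic s z = 0 := by
  simp [indic, h]

theorem halve_iterate_indic_eq (v h : ℕ) : ∀ w : ℕ,
    halve^[h] (indic (· = v)) w = if v / 2 ^ h = w then 1 / 2 ^ h else 0 := by
  induction h with
  | zero => intro w; simp [indic, eq_comm]
  | succ h ih =>
    intro w
    rw [halve_iterate_succ, ih, ih, pow_succ 2 h, ← Nat.div_div_eq_div_mul]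
    by_cases h0 : v / 2 ^ h = 2 * w
    · rw [if_pos h0, if_neg (by omega), if_pos (by omega), pow_succ]; field_simp; ring
    · by_cases h1 : v / 2 ^ h = 2 * w + 1
      · rw [if_neg h0, if_pos h1, if_pos (by omega), pow_succ]; field_simp; ring
      · rw [if_neg h0, if_neg h1, if_neg (by omega)]; simp

section Slot

variable {ι : Type} [DecidableEq ι] {cur : Finset ι → Finset ι} {L U : ℕ → ℕ}

/-- The factor 2 for passing to the right child would do; the larger factor gives the same error
term as in `abs_left_sub_le`. -/
theorem abs_right_sub_le (g : ℕ → ℝ) (p : ℕ) {d h : ℕ} (hd : 0 < d) (hdh : d ≤ h) (W : ℕ) :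
    |halve^[h - 1] g (2 * W + 1) - halve^[h] g W| ≤ 2 ^ (p + 1) * osc g d h W := by
  have e : halve^[h - 1] g = halve^[d - 1] (halve^[h - d] g) := by
    rw [← halve_iterate_add]; congr 2; omega
  rw [e]
  refine ((isMean_halve _ _).abs_sub_le _ _).trans ?_
  have := (child_le_halve (d - 1) (g := fun v => |halve^[h - d] g v - halve^[h] g W|)
    (fun _ => abs_nonneg _) W).2
  rw [show d - 1 + 1 = d by omega] at this
  refine this.trans ?_
  have h1 : (1 : ℝ) ≤ 2 ^ p := one_le_pow₀ (by norm_num)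
  have h2 := osc_nonneg g d h W
  unfold osc at h2 ⊢
  rw [pow_succ]
  nlinarith

/-- The `p` remaining elements use at most `U p` levels below the left child, so their values are
uniform below height `h - (U p + 1)`: a factor `2 ^ p` from `abs_law_sub_le` and one more for the
child. -/
theorem abs_left_sub_le (hsub : ∀ A, cur A ⊆ A)
    (hne : ∀ A : Finset ι, A.Nonempty → (cur A).Nonempty)
    (hL : ∀ p, 0 < L p) (hU : ∀ p, U (p + 1) = U p + L p) (g : ℕ → ℝ) {p h : ℕ}
    (hh : U p + 1 ≤ h) (W : ℕ) {A : Finset ι} (y : ι → ℕ) (hA : A.card = p) {j : ι} (hj : j ∈ A) :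
    |law cur L p (h - 1) (2 * W) A y (fun y' => g (y' j)) - halve^[h] g W| ≤
      2 ^ (p + 1) * osc g (U p + 1) h W := by
  refine (abs_law_sub_le hsub hne hL hU g _ (h - (U p + 1)) j p (h - 1) (2 * W) A y hA
    (by omega) hj).trans ?_
  have := (child_le_halve (U p) (g := fun v => |halve^[h - (U p + 1)] g v - halve^[h] g W|)
    (fun _ => abs_nonneg _) W).1
  rw [show h - 1 - (h - (U p + 1)) = U p by omega, pow_succ, mul_assoc]
  exact mul_le_mul_of_nonneg_left this (by positivity)

/-- The sum of the oscillations of all functions that matter for one choice. -/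
noncomputable def totalOsc (K : Finset ι) (ρ : ι → ℕ → ℕ) (R v d h W : ℕ) : ℝ :=
  ∑ i ∈ K, ∑ τ ∈ Finset.range (R + 1), osc (indic (ρ i · < τ)) d h W + osc (indic (· = v)) d h W

/-- The threshold argument for one fixed vertex `W`. Here `ρ i` is the reply round of `i` as a
function of its own value, and `v` is the answer given under silence. All deviations from uniform
leaves below `W` go into one error `E`. -/
theorem slot_bound_at_vertex (hsub : ∀ A, cur A ⊆ A)
    (hne : ∀ A : Finset ι, A.Nonempty → (cur A).Nonempty)
    (hL : ∀ p, 0 < L p) (hU : ∀ p, U (p + 1) = U p + L p)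
    {p h W R v : ℕ} {A : Finset ι} {y : ι → ℕ} (hA : A.card = p + 1)
    (hh : U p + 1 ≤ h) (hph : p + 3 ≤ h) (ρ : ι → ℕ → ℕ) (spk : ι → (ι → ℕ) → ℝ)
    (hspk : ∀ i y', 0 ≤ spk i y')
    (h1 : ∀ I ∈ cur A, ∀ z ∈ cell (h - 1) (2 * W + 1),
      ∀ y' ∈ extensions (h - 1) (2 * W) (A.erase I) (Function.update y I z),
        ∃ i ∈ cur A, ρ i (y' i) < R ∨ y' i = v)
    (h2 : ∀ I ∈ cur A, ∀ z ∈ cell (h - 1) (2 * W + 1),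
      ∀ y' ∈ extensions (h - 1) (2 * W) (A.erase I) (Function.update y I z), ∀ τ < R,
        ρ I (y' I) ≤ τ → (∀ j ∈ cur A, j ≠ I → τ ≤ ρ j (y' j)) → 1 ≤ spk I y') :
    1 / (4 * ((cur A).card : ℝ)) -
        ((cur A).card + 1) * (2 ^ (p + 1) * totalOsc (cur A) ρ R v (U p + 1) h W) ≤
      (∑ I ∈ cur A, halve^[h - 1] (fun z => law cur L p (h - 1) (2 * W) (A.erase I)
        (Function.update y I z) (spk I)) (2 * W + 1)) / (cur A).card := by
  set K := cur A with hK
  have hAne : A.Nonempty := Finset.card_pos.1 (by omega)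
  obtain ⟨I₀, hI₀⟩ : K.Nonempty := hne A hAne
  set k : ℝ := (K.card : ℝ) with hk
  have hkpos : 0 < k := Nat.cast_pos.2 (Finset.card_pos.2 ⟨I₀, hI₀⟩)
  have hk1 : 1 ≤ k := Nat.one_le_cast.2 (Finset.card_pos.2 ⟨I₀, hI₀⟩)
  set E : ℝ := 2 ^ (p + 1) * totalOsc K ρ R v (U p + 1) h W with hE
  have hcard : ∀ I ∈ K, (A.erase I).card = p := fun I hI => by
    rw [Finset.card_erase_of_mem (hsub _ hI), hA]; rfl
  have hosc : ∀ i ∈ K, ∀ τ ≤ R, osc (indic (ρ i · < τ)) (U p + 1) h W ≤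
      totalOsc K ρ R v (U p + 1) h W := by
    intro i hi τ hτ
    have a1 := Finset.single_le_sum (f := fun τ => osc (indic (ρ i · < τ)) (U p + 1) h W)
      (fun τ _ => osc_nonneg _ _ _ _) (Finset.mem_range.2 (Nat.lt_succ_of_le hτ))
    have a2 := Finset.single_le_sum
      (f := fun i => ∑ τ ∈ Finset.range (R + 1), osc (indic (ρ i · < τ)) (U p + 1) h W)
      (fun i _ => Finset.sum_nonneg fun τ _ => osc_nonneg _ _ _ _) hi
    have a3 := osc_nonneg (indic (· = v)) (U p + 1) h W
    unfold totalOsc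
    linarith
  have hoscv : osc (indic (· = v)) (U p + 1) h W ≤ totalOsc K ρ R v (U p + 1) h W := by
    unfold totalOsc
    have : 0 ≤ ∑ i ∈ K, ∑ τ ∈ Finset.range (R + 1), osc (indic (ρ i · < τ)) (U p + 1) h W :=
      Finset.sum_nonneg fun i _ => Finset.sum_nonneg fun τ _ => osc_nonneg _ _ _ _
    linarith
  have hE0 : 0 ≤ E := mul_nonneg (by positivity) ((osc_nonneg _ _ _ _).trans hoscv)
  have right : ∀ g : ℕ → ℝ, osc g (U p + 1) h W ≤ totalOsc K ρ R v (U p + 1) h W →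
      |halve^[h - 1] g (2 * W + 1) - halve^[h] g W| ≤ E := fun g hg =>
    (abs_right_sub_le g p (Nat.succ_pos _) hh W).trans
      (mul_le_mul_of_nonneg_left hg (by positivity))
  have left : ∀ g : ℕ → ℝ, osc g (U p + 1) h W ≤ totalOsc K ρ R v (U p + 1) h W →
      ∀ I ∈ K, ∀ z, ∀ j ∈ K.erase I, |law cur L p (h - 1) (2 * W) (A.erase I)
        (Function.update y I z) (fun y' => g (y' j)) - halve^[h] g W| ≤ E :=
    fun g hg I hI z j hj =>
    (abs_left_sub_le hsub hne hL hU g hh W _ (hcard I hI)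
      (Finset.erase_subset_erase _ (hsub _) hj)).trans
      (mul_le_mul_of_nonneg_left hg (by positivity))
  have mean : ∀ I ∈ K, ∀ z, IsMean
      (extensions (h - 1) (2 * W) (A.erase I) (Function.update y I z))
      (law cur L p (h - 1) (2 * W) (A.erase I) (Function.update y I z)) := fun I hI z =>
    isMean_law hsub hne hL hU p _ _ _ _ (hcard I hI) (by omega)
  have MR := isMean_halve (h - 1) (2 * W + 1)
  set q : ι → ℕ → ℝ := fun i τ => halve^[h] (indic (ρ i · < τ)) W with hq
  set qv : ℝ := halve^[h] (indic (· = v)) W with hqv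
  have hq0 : ∀ i τ, 0 ≤ q i τ := fun i τ =>
    (halve_iterate_mem_Icc (indic_nonneg _) (indic_le_one _) _ _).1
  -- The answer under silence is a single leaf, of probability at most `2 ^ (-h)`; `p + 3 ≤ h` makes
  -- this negligible for all `k ≤ p + 1` elements together.
  have hqv1 : k * qv ≤ 1 / 4 := by
    have a1 : qv ≤ 1 / 2 ^ h := by
      rw [hqv, halve_iterate_indic_eq]
      split_ifs
      · exact le_rfl
      · positivity
    have a2 : 4 * k ≤ 2 ^ h := by
      have b1 : K.card ≤ p + 1 := hA ▸ Finset.card_le_card (hsub A)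
      have b2 : p + 1 < 2 ^ (p + 1) := Nat.lt_two_pow_self
      have b3 : 2 ^ (p + 3) ≤ 2 ^ h := Nat.pow_le_pow_right (by norm_num) hph
      have b4 : 4 * K.card ≤ 2 ^ h := by
        rw [pow_succ, pow_succ] at b3; rw [pow_succ] at b2 b3; omega
      rw [hk]; exact_mod_cast b4
    have a3 : k * qv ≤ k * (1 / 2 ^ h) := mul_le_mul_of_nonneg_left a1 hkpos.le
    have a4 : k * (1 / 2 ^ h) ≤ 1 / 4 := by
      rw [mul_one_div, div_le_div_iff₀ (by positivity) (by norm_num)]; linarith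
    linarith
  -- Union bound over the elements of `K`, since one of them must reply or hold `v`. Any choice of
  -- the largest element `I₀` serves here.
  have hfinal : 1 ≤ ∑ i ∈ K, q i R + k * qv + 2 * k * E := by
    set c : ℝ := ∑ i ∈ K.erase I₀, (q i R + E + (qv + E)) with hc
    have b1 : ∀ z ∈ cell (h - 1) (2 * W + 1),
        1 ≤ indic (ρ I₀ · < R) z + indic (· = v) z + c := by
      intro z hz
      have M := mean I₀ hI₀ z
      have b2 : ∀ y' ∈ extensions (h - 1) (2 * W) (A.erase I₀) (Function.update y I₀ z),
          1 ≤ (indic (ρ I₀ · < R) z + indic (· = v) z) +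
            ∑ i ∈ K.erase I₀, (indic (ρ i · < R) (y' i) + indic (· = v) (y' i)) := by
        intro y' hy'
        obtain ⟨i, hi, hor⟩ := h1 I₀ hI₀ z hz y' hy'
        have hyI : y' I₀ = z := by rw [hy'.1 I₀ (by simp)]; simp
        have e1 := Finset.add_sum_erase K
          (fun i => indic (ρ i · < R) (y' i) + indic (· = v) (y' i)) hI₀
        simp only [hyI] at e1
        rw [e1]
        refine le_trans ?_ (Finset.single_le_sum
          (f := fun i => indic (ρ i · < R) (y' i) + indic (· = v) (y' i))
          (fun i _ => add_nonneg (indic_nonneg _ _) (indic_nonneg _ _)) hi)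
        rcases hor with hor | hor
        · rw [indic_of_true (s := (ρ i · < R)) hor]; linarith [indic_nonneg (· = v) (y' i)]
        · rw [indic_of_true (s := (· = v)) hor]; linarith [indic_nonneg (ρ i · < R) (y' i)]
      have b3 := M.mono b2
      rw [M.const, M.add, M.const, M.sum] at b3
      refine b3.trans (add_le_add le_rfl (Finset.sum_le_sum fun i hi => ?_))
      rw [M.add]
      have c1 := abs_le.1 (left _ (hosc i (Finset.mem_of_mem_erase hi) R le_rfl) I₀ hI₀ z i hi)
      have c2 := abs_le.1 (left _ hoscv I₀ hI₀ z i hi)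
      linarith [c1.2, c2.2]
    have b4 := MR.mono b1
    rw [MR.const, MR.add, MR.add, MR.const] at b4
    have c1 := abs_le.1 (right _ (hosc I₀ hI₀ R le_rfl))
    have c2 := abs_le.1 (right _ hoscv)
    have e1 := Finset.add_sum_erase K (fun i => q i R + E + (qv + E)) hI₀
    have e2 : ∑ i ∈ K, (q i R + E + (qv + E)) = ∑ i ∈ K, q i R + k * qv + 2 * k * E := by
      simp only [Finset.sum_add_distrib, Finset.sum_const, nsmul_eq_mul]; rw [← hk]; ring
    linarith [c1.2, c2.2]
  set S : ℕ → ℝ := fun τ => ∑ i ∈ K, q i τ with hS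
  -- In this case the error `E` is so large that the claimed lower bound is not positive.
  by_cases hcase : S R < 1 / 2
  · have hX : 0 ≤ (∑ I ∈ K, halve^[h - 1] (fun z => law cur L p (h - 1) (2 * W) (A.erase I)
        (Function.update y I z) (spk I)) (2 * W + 1)) / k := by
      refine div_nonneg (Finset.sum_nonneg fun I hI => ?_) hkpos.le
      rw [← MR.const 0]
      refine MR.mono fun z _ => ?_
      rw [← (mean I hI z).const 0]
      exact (mean I hI z).mono fun y' _ => hspk _ _
    refine le_trans ?_ hX
    have hkE : 1 / 8 ≤ k * E := by
      have : 1 ≤ S R + k * qv + 2 * k * E := hfinal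
      linarith
    have h4 : 1 / (4 * k) ≤ (k + 1) * E := by
      rw [div_le_iff₀ (by positivity)]
      nlinarith
    linarith
  · have hS0 : S 0 < 1 / 2 := by
      have : S 0 = 0 := Finset.sum_eq_zero fun i _ => by
        have e : indic (ρ i · < 0) = fun _ => 0 := funext fun z => indic_of_false (by simp)
        simp only [hq]
        rw [e, (isMean_halve h W).const]
      rw [this]; norm_num
    -- The round at which the expected number of replies crosses `1/2`.
    obtain ⟨τ, hτR, hτ0, hτ1⟩ : ∃ τ < R, S τ < 1 / 2 ∧ ¬ S (τ + 1) < 1 / 2 := by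
      by_contra! hno
      have : ∀ τ ≤ R, S τ < 1 / 2 := by
        intro τ
        induction τ with
        | zero => exact fun _ => hS0
        | succ τ ih => exact fun hτ => hno τ (by omega) (ih (by omega))
      exact hcase (this R le_rfl)
    rw [not_lt] at hτ1
    have hX : ∀ I ∈ K, q I (τ + 1) / 2 - (k + 1) * E ≤ halve^[h - 1] (fun z =>
        law cur L p (h - 1) (2 * W) (A.erase I) (Function.update y I z) (spk I))
          (2 * W + 1) := by
      intro I hI
      -- Whatever the value `z` of `I` is, the others reply before `τ` with total probability at
      -- most `S τ + k * E`.
      have b1 : ∀ z ∈ cell (h - 1) (2 * W + 1), (1 / 2 - k * E) * indic (ρ I · < τ + 1) z ≤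
          law cur L p (h - 1) (2 * W) (A.erase I) (Function.update y I z) (spk I) := by
        intro z hz
        have M := mean I hI z
        by_cases hz1 : ρ I z < τ + 1
        · rw [indic_of_true (s := (ρ I · < τ + 1)) hz1, mul_one]
          have b2 : ∀ y' ∈ extensions (h - 1) (2 * W) (A.erase I) (Function.update y I z),
              1 - ∑ j ∈ K.erase I, indic (ρ j · < τ) (y' j) ≤ spk I y' := by
            intro y' hy'
            have hyI : y' I = z := by rw [hy'.1 I (by simp)]; simp
            by_cases hall : ∀ j ∈ K, j ≠ I → τ ≤ ρ j (y' j)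
            · have c1 := h2 I hI z hz y' hy' τ hτR (by rw [hyI]; omega) hall
              have c2 : 0 ≤ ∑ j ∈ K.erase I, indic (ρ j · < τ) (y' j) :=
                Finset.sum_nonneg fun j _ => indic_nonneg _ _
              linarith
            · push Not at hall
              obtain ⟨j, hj, hjI, hlt⟩ := hall
              have c1 := Finset.single_le_sum (f := fun j => indic (ρ j · < τ) (y' j))
                (fun j _ => indic_nonneg _ _) (Finset.mem_erase.2 ⟨hjI, hj⟩)
              rw [indic_of_true (s := (ρ j · < τ)) hlt] at c1
              linarith [hspk I y']
          refine le_trans ?_ (M.mono b2)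
          rw [M.sub, M.const, M.sum]
          have c1 : ∑ j ∈ K.erase I, law cur L p (h - 1) (2 * W) (A.erase I)
              (Function.update y I z) (fun y' => indic (ρ j · < τ) (y' j)) ≤
              ∑ j ∈ K.erase I, (q j τ + E) := Finset.sum_le_sum fun j hj => by
            have := abs_le.1 (left _ (hosc j (Finset.mem_of_mem_erase hj) τ hτR.le) I hI z j hj)
            linarith [this.2]
          have c2 : ∑ j ∈ K.erase I, (q j τ + E) ≤ ∑ j ∈ K, (q j τ + E) :=
            Finset.sum_le_sum_of_subset_of_nonneg (Finset.erase_subset _ _)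
              fun j _ _ => add_nonneg (hq0 _ _) hE0
          have c3 : ∑ j ∈ K, (q j τ + E) = S τ + k * E := by
            rw [Finset.sum_add_distrib, Finset.sum_const, nsmul_eq_mul]
          linarith
        · rw [indic_of_false (s := (ρ I · < τ + 1)) hz1, mul_zero, ← M.const 0]
          exact M.mono fun y' _ => hspk _ _
      refine le_trans ?_ (MR.mono b1)
      rw [MR.const_mul]
      have c1 := abs_le.1 (right _ (hosc I hI (τ + 1) hτR))
      have c2 := halve_iterate_mem_Icc (indic_nonneg (ρ I · < τ + 1))
        (indic_le_one (ρ I · < τ + 1)) (h - 1) (2 * W + 1)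
      set q' := halve^[h - 1] (indic (ρ I · < τ + 1)) (2 * W + 1)
      have c3 : q' * (k * E) ≤ 1 * (k * E) :=
        mul_le_mul_of_nonneg_right c2.2 (mul_nonneg hkpos.le hE0)
      have c4 : q I (τ + 1) - E ≤ q' := by linarith [c1.1]
      nlinarith
    have hsum := Finset.sum_le_sum hX
    rw [Finset.sum_sub_distrib, Finset.sum_const, nsmul_eq_mul, ← Finset.sum_div, ← hk] at hsum
    rw [le_div_iff₀ hkpos]
    have : (1 / (4 * k) - (k + 1) * E) * k = 1 / 4 - k * ((k + 1) * E) := by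
      field_simp
    rw [this]
    have : (1 / 2) / 2 ≤ (∑ i ∈ K, q i (τ + 1)) / 2 := by
      have : 1 / 2 ≤ ∑ i ∈ K, q i (τ + 1) := hτ1
      linarith
    linarith

/-- A number of levels that is ample for `p + 1` elements. -/
def granularity (R p : ℕ) : ℕ := 8 * (p + 1) * ((p + 2) * 2 ^ (p + 1) * ((p + 1) * (R + 1) + 1))

/-- Averaging `slot_bound_at_vertex` over the random height turns the error into a mean oscillation,
which costs at most half of `1 / (4 k)`. -/
theorem slot_bound (hsub : ∀ A, cur A ⊆ A)
    (hne : ∀ A : Finset ι, A.Nonempty → (cur A).Nonempty)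
    (hL : ∀ p, 0 < L p) (hU : ∀ p, U (p + 1) = U p + L p)
    {p ℓ w R v : ℕ} {A : Finset ι} {y : ι → ℕ} (hA : A.card = p + 1)
    (hLp : (U p + 1) * granularity R p ^ 2 ≤ L p)
    (hℓ : U (p + 1) + (p + 2) ≤ ℓ) (ρ : ι → ℕ → ℕ) (spk : ι → (ι → ℕ) → ℝ)
    (hspk : ∀ i y', 0 ≤ spk i y')
    (h1 : ∀ y' ∈ extensions ℓ w A y, ∃ i ∈ cur A, ρ i (y' i) < R ∨ y' i = v)
    (h2 : ∀ y' ∈ extensions ℓ w A y, ∀ I ∈ cur A, ∀ τ < R,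
        ρ I (y' I) ≤ τ → (∀ j ∈ cur A, j ≠ I → τ ≤ ρ j (y' j)) → 1 ≤ spk I y') :
    1 / (8 * ((cur A).card : ℝ)) ≤
      (∑ I ∈ cur A, (∑ a ∈ Finset.range (L p), halve^[a] (fun W => halve^[ℓ - a - 1] (fun z =>
        law cur L p (ℓ - a - 1) (2 * W) (A.erase I) (Function.update y I z) (spk I))
          (2 * W + 1)) w) / (Finset.range (L p)).card) / (cur A).card := by
  set K := cur A with hK
  have hAne : A.Nonempty := Finset.card_pos.1 (by omega)
  have hKpos : 0 < K.card := Finset.card_pos.2 (hne A hAne)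
  have hKp : K.card ≤ p + 1 := hA ▸ Finset.card_le_card (hsub A)
  set k : ℝ := (K.card : ℝ) with hk
  have hkpos : 0 < k := Nat.cast_pos.2 hKpos
  have hkp : k ≤ p + 1 := by rw [hk]; exact_mod_cast hKp
  set d := U p + 1 with hd
  rw [hU] at hℓ
  have hLpos : (0 : ℝ) < L p := by exact_mod_cast hL p
  set T : ℕ → ℕ → ℝ := fun h => totalOsc K ρ R v d h with hT
  have hvert : ∀ a ∈ Finset.range (L p), 1 / (4 * k) - (k + 1) * (2 ^ (p + 1) *
      halve^[a] (T (ℓ - a)) w) ≤ (∑ I ∈ K, halve^[a] (fun W => halve^[ℓ - a - 1] (fun z =>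
        law cur L p (ℓ - a - 1) (2 * W) (A.erase I) (Function.update y I z) (spk I))
          (2 * W + 1)) w) / k := by
    intro a ha
    rw [Finset.mem_range] at ha
    have M := isMean_halve a w
    have := M.mono (F := fun W => 1 / (4 * k) - (k + 1) * (2 ^ (p + 1) * T (ℓ - a) W))
      (G := fun W => k⁻¹ * ∑ I ∈ K, halve^[ℓ - a - 1] (fun z =>
        law cur L p (ℓ - a - 1) (2 * W) (A.erase I) (Function.update y I z) (spk I))
          (2 * W + 1)) fun W hW => by
      have b := slot_bound_at_vertex hsub hne hL hU (h := ℓ - a) (W := W) (v := v) (R := R)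
        (y := y) hA (by omega) (by omega) ρ spk hspk
        (fun I hI z hz y' hy' => h1 y' (extensions_step (hsub _ hI) (by omega) hW hz hy'))
        (fun I hI z hz y' hy' => h2 y' (extensions_step (hsub _ hI) (by omega) hW hz hy') I hI)
      rwa [div_eq_inv_mul _ ((cur A).card : ℝ)] at b
    rw [M.sub, M.const, M.const_mul, M.const_mul, M.const_mul, M.sum] at this
    rwa [div_eq_inv_mul _ k]
  have hsumT : ∑ a ∈ Finset.range (L p), halve^[a] (T (ℓ - a)) w ≤
      ((p + 1) * (R + 1) + 1) * (L p / granularity R p) := by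
    set B : ℝ := (granularity R p : ℝ) with hB
    have hBpos : 0 < B := by
      rw [hB]; unfold granularity; positivity
    have one : ∀ s : ℕ → Prop, ∑ a ∈ Finset.range (L p), halve^[a] (osc (indic s) d (ℓ - a)) w
        ≤ L p / B := by
      -- With `δ = 1 / B` and `d * B ^ 2 ≤ L p`, both terms of `sum_osc_le` are at most `L p / (2 *
      -- B)`.
      intro s
      refine (sum_osc_le (indic_nonneg s) (indic_le_one s) (by omega) w
        (δ := 1 / B) (by positivity)).trans ?_
      have hLp' : (d : ℝ) * B ^ 2 ≤ L p := by rw [hB]; exact_mod_cast hLp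
      have : (d : ℝ) / (2 * (1 / B)) ≤ L p / B / 2 := by
        rw [div_div, div_le_div_iff₀ (by positivity) (by positivity)]
        have e : (d : ℝ) * (B * 2) = d * B ^ 2 * (2 * (1 / B)) := by field_simp
        rw [e]
        exact mul_le_mul_of_nonneg_right hLp' (by positivity)
      have e : (L p : ℝ) * (1 / B / 2) = L p / B / 2 := by ring
      linarith
    have e : ∀ a, halve^[a] (T (ℓ - a)) w = ∑ i ∈ K, ∑ τ ∈ Finset.range (R + 1),
        halve^[a] (osc (indic (ρ i · < τ)) d (ℓ - a)) w +
          halve^[a] (osc (indic (· = v)) d (ℓ - a)) w := by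
      intro a
      have M := isMean_halve a w
      have : T (ℓ - a) = fun W => (∑ i ∈ K, ∑ τ ∈ Finset.range (R + 1),
        osc (indic (ρ i · < τ)) d (ℓ - a) W) + osc (indic (· = v)) d (ℓ - a) W := rfl
      rw [this, M.add, M.sum]
      congr 1
      exact Finset.sum_congr rfl fun i _ => M.sum _ _
    simp only [e]
    rw [Finset.sum_add_distrib, Finset.sum_comm]
    have a1 : ∑ i ∈ K, ∑ a ∈ Finset.range (L p), ∑ τ ∈ Finset.range (R + 1),
        halve^[a] (osc (indic (ρ i · < τ)) d (ℓ - a)) w ≤ k * ((R + 1) * (L p / B)) := by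
      rw [hk, ← nsmul_eq_mul]
      refine Finset.sum_le_card_nsmul _ _ _ fun i _ => ?_
      rw [Finset.sum_comm]
      refine (Finset.sum_le_card_nsmul _ _ _ fun τ _ => one _).trans ?_
      rw [nsmul_eq_mul, Finset.card_range]
      push_cast
      exact le_rfl
    have a2 := one (· = v)
    have a3 : k * ((R + 1) * (L p / B)) ≤ (p + 1) * ((R + 1) * (L p / B)) :=
      mul_le_mul_of_nonneg_right hkp (by positivity)
    calc _ ≤ k * ((R + 1) * (L p / B)) + L p / B := add_le_add a1 a2
      _ ≤ _ := by linarith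
  have hswap : (∑ I ∈ K, (∑ a ∈ Finset.range (L p), halve^[a] (fun W => halve^[ℓ - a - 1]
      (fun z => law cur L p (ℓ - a - 1) (2 * W) (A.erase I) (Function.update y I z) (spk I))
          (2 * W + 1)) w) / (Finset.range (L p)).card) / k
      = (∑ a ∈ Finset.range (L p), (∑ I ∈ K, halve^[a] (fun W => halve^[ℓ - a - 1]
      (fun z => law cur L p (ℓ - a - 1) (2 * W) (A.erase I) (Function.update y I z) (spk I))
          (2 * W + 1)) w) / k) / L p := by
    rw [← Finset.sum_div, ← Finset.sum_div, Finset.sum_comm, Finset.card_range, div_right_comm]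
  rw [hswap, le_div_iff₀ hLpos]
  refine le_trans ?_ (Finset.sum_le_sum hvert)
  rw [Finset.sum_sub_distrib, Finset.sum_const, Finset.card_range, nsmul_eq_mul,
    ← Finset.mul_sum, ← Finset.mul_sum]
  set Z : ℝ := ((p : ℝ) + 2) * 2 ^ (p + 1) * ((p + 1) * (R + 1) + 1) with hZ
  have hZpos : 0 < Z := by positivity
  have hB : (granularity R p : ℝ) = 8 * (p + 1) * Z := by
    unfold granularity; push_cast; rfl
  -- The factor `Z` collects `k + 1 ≤ p + 2`, the density `2 ^ (p + 1)` and the bound on the number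
  -- of indicator functions; `granularity` exceeds it by `8 (p + 1)`, which leaves an error of at
  -- most `1 / (8 k)` per height.
  have c1 : (k + 1) * (2 ^ (p + 1) * ∑ a ∈ Finset.range (L p), halve^[a] (T (ℓ - a)) w) ≤
      (p + 2) * (2 ^ (p + 1) * (((p + 1) * (R + 1) + 1) * (L p / granularity R p))) := by
    refine (mul_le_mul_of_nonneg_left (mul_le_mul_of_nonneg_left hsumT (by positivity))
      (by positivity)).trans (mul_le_mul_of_nonneg_right (by linarith) (by positivity))
  have c2 : (p + 2) * (2 ^ (p + 1) * (((p + 1) * (R + 1) + 1) * (L p / granularity R p)))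
      = L p / (8 * ((p : ℝ) + 1)) := by
    have : (p + 2) * (2 ^ (p + 1) * (((p + 1) * (R + 1) + 1) * (L p / granularity R p)))
      = Z * (L p / (granularity R p : ℝ)) := by rw [hZ]; ring
    rw [this, hB]
    field_simp
  have c3 : (L p : ℝ) / (8 * ((p : ℝ) + 1)) ≤ L p / (8 * k) :=
    div_le_div_of_nonneg_left hLpos.le (by positivity) (by linarith)
  have c4 : (L p : ℝ) * (1 / (4 * k)) = 2 * (L p / (8 * k)) := by field_simp; norm_num
  have c5 : 1 / (8 * k) * (L p : ℝ) = L p / (8 * k) := by ring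
  rw [c4, c5]
  linarith

end Slot

/-! ### Executions with ignored replies -/

namespace Protocol

variable {n : ℕ} {D M Q S : Type*}

theorem run_congr (P : Protocol n D M Q S) (R : ℕ) {x x' : ℕ → Fin n → D} {t : ℕ}
    (h : ∀ s < t, x s = x' s) : P.run R x t = P.run R x' t := by
  induction t with
  | zero => rfl
  | succ t ih =>
    simp only [run]
    rw [ih fun s hs => h s (Nat.lt_succ_of_lt hs), h t (Nat.lt_succ_self t)]

/-- A communication round in which the server does not notice the replies of the nodes in `K`. -/
def quietRound (P : Protocol n D M Q S) (K : Finset (Fin n)) (C : Config n Q S) :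
    Config n Q S where
  nodes := P.heard C
  server := P.collect (fun i => if i ∈ K then none else P.replies C i) C.server
  messages := C.messages + P.roundCost C

/-- Nodes interact through the server only. If it ignores `K`, the items of `K` influence neither
the server nor any other node. -/
theorem quietRound_agree (P : Protocol n D M Q S) (K : Finset (Fin n)) {C C' : Config n Q S}
    (hs : C.server = C'.server) (hn : ∀ i, i ∉ K → C.nodes i = C'.nodes i) (r : ℕ) :
    ((P.quietRound K)^[r] C).server = ((P.quietRound K)^[r] C').server ∧
      ∀ i, C.nodes i = C'.nodes i →
        ((P.quietRound K)^[r] C).nodes i = ((P.quietRound K)^[r] C').nodes i := by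
  induction r with
  | zero => exact ⟨hs, fun _ h => h⟩
  | succ r ih =>
    rw [Function.iterate_succ_apply', Function.iterate_succ_apply']
    obtain ⟨h1, h2⟩ := ih
    have h3 : ∀ i, C.nodes i = C'.nodes i → P.heard ((P.quietRound K)^[r] C) i =
        P.heard ((P.quietRound K)^[r] C') i := fun i hi => by
      simp only [heard, h1, h2 i hi]
    refine ⟨?_, h3⟩
    simp only [quietRound]
    rw [h1]
    congr 1
    funext i
    by_cases hi : i ∈ K
    · simp [hi]
    · simp only [hi, if_false, replies, h3 i (hn i hi)]

theorem round_iterate_eq_quietRound (P : Protocol n D M Q S) (K : Finset (Fin n))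
    (C : Config n Q S) {r : ℕ}
    (h : ∀ r' < r, ∀ i ∈ K, P.replies ((P.quietRound K)^[r'] C) i = none) :
    P.round^[r] C = (P.quietRound K)^[r] C := by
  induction r with
  | zero => rfl
  | succ r ih =>
    rw [Function.iterate_succ_apply', Function.iterate_succ_apply',
      ih fun r' hr' => h r' (Nat.lt_succ_of_lt hr')]
    have : (fun i => if i ∈ K then none else P.replies ((P.quietRound K)^[r] C) i) =
        P.replies ((P.quietRound K)^[r] C) := by
      funext i
      by_cases hi : i ∈ K
      · simp [hi, h r (Nat.lt_succ_self r) i hi]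
      · simp [hi]
    simp only [round, quietRound, this]

/-- The first round in which node `i` replies when the replies of `K` get lost, and `R` if that does
not happen in the first `R` rounds. -/
noncomputable def firstReply (P : Protocol n D M Q S) (K : Finset (Fin n)) (R : ℕ)
    (C : Config n Q S) (i : Fin n) : ℕ :=
  sInf {r | R ≤ r ∨ (P.replies ((P.quietRound K)^[r] C) i).isSome}

theorem replies_eq_none_of_lt_firstReply (P : Protocol n D M Q S) (K : Finset (Fin n)) {R : ℕ}
    {C : Config n Q S} {i : Fin n} {r : ℕ} (h : r < P.firstReply K R C i) :
    P.replies ((P.quietRound K)^[r] C) i = none := by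
  have := Nat.notMem_of_lt_sInf h
  simpa using fun hs => this (Or.inr hs)

theorem isSome_replies_firstReply (P : Protocol n D M Q S) (K : Finset (Fin n)) {R : ℕ}
    {C : Config n Q S} {i : Fin n} (h : P.firstReply K R C i < R) :
    (P.replies ((P.quietRound K)^[P.firstReply K R C i] C) i).isSome := by
  have hne : {r | R ≤ r ∨ (P.replies ((P.quietRound K)^[r] C) i).isSome}.Nonempty :=
    ⟨R, Or.inl le_rfl⟩
  rcases Nat.sInf_mem hne with h' | h'
  · exact absurd h (not_lt.2 h')
  · exact h'

/-- This makes the reply round a function of the node's own item once everything outside `K` is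
fixed. -/
theorem firstReply_congr (P : Protocol n D M Q S) (K : Finset (Fin n)) (R : ℕ)
    {C C' : Config n Q S} {i : Fin n} (hs : C.server = C'.server)
    (hn : ∀ i, i ∉ K → C.nodes i = C'.nodes i) (hi : C.nodes i = C'.nodes i) :
    P.firstReply K R C i = P.firstReply K R C' i := by
  have : ∀ r, P.replies ((P.quietRound K)^[r] C) i = P.replies ((P.quietRound K)^[r] C') i := by
    intro r
    obtain ⟨h1, h2⟩ := P.quietRound_agree K hs hn r
    simp only [replies, heard, h1, h2 i hi]
  simp only [firstReply, this]

/-! ### Counting messages -/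

/-- Node `i` sends a message to the server at time step `t`. -/
def Speaks (P : Protocol n D M Q S) (R : ℕ) (x : ℕ → Fin n → D) (t : ℕ) (i : Fin n) : Prop :=
  ∃ r < R, (P.replies (P.round^[r] (P.read (x t) (P.run R x t))) i).isSome

open Classical in
theorem messages_round_iterate (P : Protocol n D M Q S) (C : Config n Q S) (R : ℕ) :
    C.messages + (Finset.univ.filter fun i => ∃ r < R, (P.replies (P.round^[r] C) i).isSome).card ≤
      (P.round^[R] C).messages := by
  induction R with
  | zero => simp
  | succ R ih =>
    rw [Function.iterate_succ_apply']
    have h1 : (Finset.univ.filter fun i => ∃ r < R + 1, (P.replies (P.round^[r] C) i).isSome) ⊆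
        (Finset.univ.filter fun i => ∃ r < R, (P.replies (P.round^[r] C) i).isSome) ∪
          (Finset.univ.filter fun i => (P.replies (P.round^[R] C) i).isSome) := by
      intro i hi
      simp only [Finset.mem_union, Finset.mem_filter, Finset.mem_univ, true_and] at hi ⊢
      obtain ⟨r, hr, h⟩ := hi
      rcases Nat.lt_succ_iff_lt_or_eq.1 hr with h' | rfl
      · exact Or.inl ⟨r, h', h⟩
      · exact Or.inr h
    have h2 := (Finset.card_le_card h1).trans (Finset.card_union_le _ _)
    have h3 : (P.round (P.round^[R] C)).messages =
        (P.round^[R] C).messages + P.roundCost (P.round^[R] C) := rfl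
    have h4 : (Finset.univ.filter fun i => (P.replies (P.round^[R] C) i).isSome).card ≤
        P.roundCost (P.round^[R] C) := by
      unfold roundCost
      exact Nat.le_add_left _ _
    omega

open Classical in
theorem sum_card_speaks_le (P : Protocol n D M Q S) (R : ℕ) (x : ℕ → Fin n → D) (T : ℕ) :
    ∑ t ∈ Finset.range T, (Finset.univ.filter fun i => P.Speaks R x t i).card ≤
      (P.run R x T).messages := by
  induction T with
  | zero => simp
  | succ T ih =>
    rw [Finset.sum_range_succ]
    refine le_trans ?_ (P.messages_round_iterate (P.read (x T) (P.run R x T)) R)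
    exact Nat.add_le_add ih (le_of_eq (by simp only [Speaks]; congr))

/-- A crude bound that provides integrability of the message count. -/
theorem messages_le (P : Protocol n D M Q S) (R : ℕ) (x : ℕ → Fin n → D) (T : ℕ) :
    (P.run R x T).messages ≤ T * (R * (1 + n + n)) := by
  have hc : ∀ C : Config n Q S, P.roundCost C ≤ 1 + n + n := by
    intro C
    unfold roundCost
    have h1 : (if (P.broadcast C.server).isSome then 1 else 0) ≤ 1 := by split_ifs <;> simp
    have h2 := Finset.card_filter_le (Finset.univ : Finset (Fin n))
      fun i => (P.unicast C.server i).isSome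
    have h3 := Finset.card_filter_le (Finset.univ : Finset (Fin n))
      fun i => (P.replies C i).isSome
    rw [Finset.card_univ, Fintype.card_fin] at h2 h3
    omega
  have hr : ∀ (C : Config n Q S) (r : ℕ),
      (P.round^[r] C).messages ≤ C.messages + r * (1 + n + n) := by
    intro C r
    induction r with
    | zero => simp
    | succ r ih =>
      rw [Function.iterate_succ_apply']
      have h3 : (P.round (P.round^[r] C)).messages =
        (P.round^[r] C).messages + P.roundCost (P.round^[r] C) := rfl
      have h4 := hc (P.round^[r] C)
      rw [Nat.succ_mul]
      omega
  induction T with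
  | zero => simp [run, init]
  | succ T ih =>
    have h := hr (P.read (x T) (P.run R x T)) R
    have h' : (P.read (x T) (P.run R x T)).messages = (P.run R x T).messages := rfl
    rw [Nat.succ_mul]
    simp only [run]
    omega

end Protocol

/-! ### Slots and the inputs built from them -/

/-- The time and the node at which the item of node `i` at time `t` has been observed first, if the
nodes `0, …, m - 1` get new items in every time step before `T`. -/
def source {n T : ℕ} (hT : 0 < T) (m t : ℕ) (i : Fin n) : Fin T × Fin n :=
  -- Times `t ≥ T` are irrelevant and get the item of time 0.
  if h : t < T ∧ i.val < m then (⟨t, h.1⟩, i) else (⟨0, hT⟩, i)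

/-- The times and nodes at which a new item is observed. -/
def slots (n m T : ℕ) : Finset (Fin T × Fin n) :=
  Finset.univ.filter fun s => s.1.val = 0 ∨ s.2.val < m

/-- The elements of `A` with the smallest time. -/
def earliest {n T : ℕ} (A : Finset (Fin T × Fin n)) : Finset (Fin T × Fin n) :=
  A.filter fun s => ∀ s' ∈ A, s.1 ≤ s'.1

/-- The input sequence whose new items are given by `y`. -/
def inputOf {n T : ℕ} {D : Type*} (hT : 0 < T) (m : ℕ) (e : ℕ → D) (y : Fin T × Fin n → ℕ)
    (t : ℕ) (i : Fin n) : D :=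
  e (y (source hT m t i))

section Slots

variable {n m T : ℕ} (hT : 0 < T)

theorem source_snd (t : ℕ) (i : Fin n) : (source hT m t i).2 = i := by
  unfold source; split_ifs <;> rfl

theorem source_fst_le (t : ℕ) (i : Fin n) : (source hT m t i).1.val ≤ t := by
  unfold source; split_ifs <;> simp

theorem source_mem_slots (t : ℕ) (i : Fin n) : source hT m t i ∈ slots n m T := by
  unfold source slots
  split_ifs with h
  · simp [h.2]
  · simp

theorem source_of_mem_slots {s : Fin T × Fin n} (hs : s ∈ slots n m T) :
    source hT m s.1 s.2 = s := by
  obtain ⟨t, i⟩ := s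
  simp only [slots, Finset.mem_filter, Finset.mem_univ, true_and] at hs
  unfold source
  split_ifs with h
  · rfl
  · have : t.val = 0 := by
      rcases hs with hs | hs
      · exact hs
      · exact absurd ⟨t.2, hs⟩ h
    ext <;> simp [this]

theorem earliest_subset (A : Finset (Fin T × Fin n)) : earliest A ⊆ A :=
  Finset.filter_subset _ _

theorem earliest_nonempty (A : Finset (Fin T × Fin n)) (hA : A.Nonempty) :
    (earliest A).Nonempty := by
  obtain ⟨s, hs, h⟩ := Finset.exists_min_image A (fun s => s.1) hA
  exact ⟨s, Finset.mem_filter.2 ⟨hs, h⟩⟩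

theorem earliest_eq_filter {A : Finset (Fin T × Fin n)} {I : Fin T × Fin n}
    (hI : I ∈ earliest A) : earliest A = A.filter fun s => s.1 = I.1 := by
  ext s
  simp only [earliest, Finset.mem_filter] at hI ⊢
  constructor
  · rintro ⟨h1, h2⟩
    exact ⟨h1, le_antisymm (h2 I hI.1) (hI.2 s h1)⟩
  · rintro ⟨h1, h2⟩
    exact ⟨h1, fun s' hs' => h2 ▸ hI.2 s' hs'⟩

/-- The items outside `A` have been chosen, distinct and above the vertex `w` of height `ℓ`. -/
structure PartialInput (n m T N ℓ w : ℕ) (A : Finset (Fin T × Fin n)) (y : Fin T × Fin n → ℕ) :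
    Prop where
  subset : A ⊆ slots n m T
  lt : ∀ s ∈ slots n m T, s ∉ A → y s < N
  above : ∀ s ∈ slots n m T, s ∉ A → (w + 1) * 2 ^ ℓ ≤ y s
  inj : ∀ s ∈ slots n m T, s ∉ A → ∀ s' ∈ slots n m T, s' ∉ A → y s = y s' → s = s'
  below : (w + 1) * 2 ^ ℓ ≤ N

theorem lt_of_mem_cell {a w z : ℕ} (h : z ∈ cell a w) : z < (w + 1) * 2 ^ a := by
  simp only [cell, Set.mem_ofPred_eq] at h
  rw [← h]
  exact (Nat.div_lt_iff_lt_mul (by positivity)).1 (Nat.lt_succ_self _)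

theorem le_of_mem_cell {a w z : ℕ} (h : z ∈ cell a w) : w * 2 ^ a ≤ z := by
  simp only [cell, Set.mem_ofPred_eq] at h
  rw [← h]
  exact Nat.div_mul_le_self _ _

end Slots

section Deterministic

variable {n m T : ℕ} (hT : 0 < T)

/-- The item of `I` lies below the right child, hence above everything still to be placed below the
left child and under everything placed before. -/
theorem PartialInput.step {N ℓ w : ℕ} {A : Finset (Fin T × Fin n)} {y : Fin T × Fin n → ℕ}
    (h : PartialInput n m T N ℓ w A y) {I : Fin T × Fin n} {a W z : ℕ}
    (ha : a + 1 ≤ ℓ) (hW : W ∈ cell a w) (hz : z ∈ cell (ℓ - a - 1) (2 * W + 1)) :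
    PartialInput n m T N (ℓ - a - 1) (2 * W) (A.erase I) (Function.update y I z) := by
  have hz' : z ∈ cell ℓ w := by
    have := mem_cell_add (mem_cell_add hz (right_mem_cell W)) hW
    rwa [show a + (1 + (ℓ - a - 1)) = ℓ by omega] at this
  have h1 := lt_of_mem_cell hz'
  have h2 := le_of_mem_cell hz
  have hb := h.below
  have hA : ∀ s, s ≠ I → s ∉ A.erase I → s ∉ A := fun s hs hs' hsA =>
    hs' (Finset.mem_erase.2 ⟨hs, hsA⟩)
  refine ⟨(Finset.erase_subset _ _).trans h.subset, fun s hs hsA => ?_, fun s hs hsA => ?_,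
    fun s hs hsA s' hs' hsA' heq => ?_, by omega⟩
  · by_cases hsI : s = I
    · subst hsI; rw [Function.update_self]; omega
    · rw [Function.update_of_ne hsI]; exact h.lt s hs (hA s hsI hsA)
  · by_cases hsI : s = I
    · subst hsI; rw [Function.update_self]; exact h2
    · rw [Function.update_of_ne hsI]
      have := h.above s hs (hA s hsI hsA)
      omega
  · by_cases hsI : s = I
    · by_cases hsI' : s' = I
      · rw [hsI, hsI']
      · rw [hsI, Function.update_self, Function.update_of_ne hsI'] at heq
        have := h.above s' hs' (hA s' hsI' hsA')
        omega
    · by_cases hsI' : s' = I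
      · rw [hsI', Function.update_self, Function.update_of_ne hsI] at heq
        have := h.above s hs (hA s hsI hsA)
        omega
      · rw [Function.update_of_ne hsI, Function.update_of_ne hsI'] at heq
        exact h.inj s hs (hA s hsI hsA) s' hs' (hA s' hsI' hsA') heq

theorem PartialInput.extension {N ℓ w : ℕ} {A : Finset (Fin T × Fin n)} {y y' : Fin T × Fin n → ℕ}
    (h : PartialInput n m T N ℓ w A y) (hy' : y' ∈ extensions ℓ w A y) :
    (∀ s ∈ slots n m T, y' s < N) ∧
      ∀ s ∈ slots n m T, ∀ s' ∈ slots n m T, y' s = y' s' → s = s' := by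
  obtain ⟨h1, h2, h3⟩ := hy'
  have hb := h.below
  refine ⟨fun s hs => ?_, fun s hs s' hs' heq => ?_⟩
  · by_cases hsA : s ∈ A
    · have := lt_of_mem_cell (h3 s hsA); omega
    · rw [h1 s hsA]; exact h.lt s hs hsA
  · by_cases hsA : s ∈ A
    · by_cases hsA' : s' ∈ A
      · exact h2 hsA hsA' heq
      · have a1 := lt_of_mem_cell (h3 s hsA)
        have a2 := h.above s' hs' hsA'
        rw [h1 s' hsA'] at heq; omega
    · by_cases hsA' : s' ∈ A
      · have a1 := lt_of_mem_cell (h3 s' hsA')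
        have a2 := h.above s hs hsA
        rw [h1 s hsA] at heq; omega
      · rw [h1 s hsA, h1 s' hsA'] at heq
        exact h.inj s hs hsA s' hs' hsA' heq

variable {D M Q S : Type*}

/-- Different slots carry different items, so a node's item changes exactly when its source does,
that is, for the first `m` nodes. -/
theorem isInput_inputOf [LinearOrder D] (hmn : m ≤ n) {N : ℕ} {e : ℕ → D} (he : StrictMonoOn e (Set.Iio N))
    {y : Fin T × Fin n → ℕ} (hN : ∀ s ∈ slots n m T, y s < N)
    (hinj : ∀ s ∈ slots n m T, ∀ s' ∈ slots n m T, y s = y s' → s = s') :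
    IsInput m T (inputOf hT m e y) := by
  have key : ∀ t i t' i', inputOf hT m e y t i = inputOf hT m e y t' i' →
      source hT m t i = source hT m t' i' := fun t i t' i' h =>
    hinj _ (source_mem_slots hT t i) _ (source_mem_slots hT t' i')
      (he.injOn (hN _ (source_mem_slots hT t i)) (hN _ (source_mem_slots hT t' i')) h)
  refine ⟨fun t _ i i' h => ?_, fun t ht => ?_⟩
  · have := congrArg Prod.snd (key t i t i' h)
    rwa [source_snd, source_snd] at this
  · have hset : ∀ i : Fin n, inputOf hT m e y (t + 1) i ≠ inputOf hT m e y t i ↔ i.val < m := by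
      intro i
      constructor
      · intro h
        by_contra him
        apply h
        unfold inputOf source
        rw [dif_neg (fun h => him h.2), dif_neg (fun h => him h.2)]
      · intro him h
        have h1 := congrArg (fun s => s.1.val) (key _ _ _ _ h)
        have h2 := source_fst_le (m := m) hT t i
        have h3 : (source hT m (t + 1) i).1.val = t + 1 := by
          unfold source; rw [dif_pos ⟨ht, him⟩]
        simp only [h3] at h1
        omega
    have : (Finset.univ.filter fun i : Fin n =>
        inputOf hT m e y (t + 1) i ≠ inputOf hT m e y t i) =
        Finset.univ.filter fun i : Fin n => i.val < m :=
      Finset.filter_congr fun i _ => hset i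
    rw [this, Fin.card_filter_val_lt, min_eq_right hmn]

/-- The indicator function of the event that the node of the slot `s` sends a message at the time
of `s`. -/
noncomputable def speaks (P : Protocol n D M Q S) (R : ℕ) (e : ℕ → D) (s : Fin T × Fin n)
    (y : Fin T × Fin n → ℕ) : ℝ := by
  classical exact if P.Speaks R (inputOf hT m e y) s.1 s.2 then 1 else 0

theorem speaks_nonneg (P : Protocol n D M Q S) (R : ℕ) (e : ℕ → D) (s : Fin T × Fin n)
    (y : Fin T × Fin n → ℕ) : 0 ≤ speaks (m := m) hT P R e s y := by
  unfold speaks; split_ifs <;> norm_num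

theorem sum_speaks_le (P : Protocol n D M Q S) (R : ℕ) (e : ℕ → D) (y : Fin T × Fin n → ℕ)
    (A : Finset (Fin T × Fin n)) :
    ∑ s ∈ A, speaks (m := m) hT P R e s y ≤ (P.run R (inputOf hT m e y) T).messages := by
  classical
  refine (Finset.sum_le_sum_of_subset_of_nonneg (Finset.subset_univ A)
    fun s _ _ => speaks_nonneg hT P R e s y).trans ?_
  refine le_trans (le_of_eq ?_)
    (Nat.cast_le.2 (P.sum_card_speaks_le R (inputOf hT m e y) T))
  rw [Fintype.sum_prod_type, ← Fin.sum_univ_eq_sum_range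
    (fun t => (Finset.univ.filter fun i => P.Speaks R (inputOf hT m e y) t i).card)]
  push_cast
  refine Finset.sum_congr rfl fun t _ => ?_
  unfold speaks
  rw [Finset.sum_boole]

/-- In a partial input, the nodes of the earliest slots are in the situation of `slot_bound`. -/
theorem PartialInput.exists_firstReply [LinearOrder D] (hmn : m ≤ n) {N ℓ w R : ℕ} {e : ℕ → D}
    (he : StrictMonoOn e (Set.Iio N)) (P : Protocol n D M Q S)
    (hP : ∀ y : Fin T × Fin n → ℕ, IsInput m T (inputOf hT m e y) →
      P.TracksMinOn R T (inputOf hT m e y))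
    {A : Finset (Fin T × Fin n)} {y : Fin T × Fin n → ℕ}
    (h : PartialInput n m T N ℓ w A y) (hA : A.Nonempty) :
    ∃ (ρ : Fin T × Fin n → ℕ → ℕ) (v : ℕ),
      (∀ y' ∈ extensions ℓ w A y, ∃ i ∈ earliest A, ρ i (y' i) < R ∨ y' i = v) ∧
      (∀ y' ∈ extensions ℓ w A y, ∀ I ∈ earliest A, ∀ τ < R,
        ρ I (y' I) ≤ τ → (∀ j ∈ earliest A, j ≠ I → τ ≤ ρ j (y' j)) →
          1 ≤ speaks (m := m) hT P R e I y') := by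
  classical
  obtain ⟨I₀, hI₀⟩ := earliest_nonempty A hA
  have hI₀A := earliest_subset A hI₀
  set t : Fin T := I₀.1 with ht
  have htime : ∀ s ∈ A, t ≤ s.1 := fun s hs => (Finset.mem_filter.1 hI₀).2 s hs
  have hearly : ∀ s, s ∈ earliest A ↔ s ∈ A ∧ s.1 = t := fun s => by
    rw [earliest_eq_filter hI₀, Finset.mem_filter]
  set K : Finset (Fin n) := Finset.univ.filter fun i => (t, i) ∈ A with hK
  have hKsrc : ∀ i, source hT m t i ∈ A → i ∈ K := by
    intro i hi
    have h1 := htime _ hi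
    have h2 := source_fst_le (m := m) hT t i
    have h3 : source hT m t i = (t, i) :=
      Prod.ext (le_antisymm h2 h1) (source_snd hT t i)
    rw [h3] at hi
    simp [hK, hi]
  set conf : (Fin T × Fin n → ℕ) → Config n Q S := fun y' =>
    P.read (inputOf hT m e y' t) (P.run R (inputOf hT m e y') t) with hconf
  -- All open slots have time at least `t`, so the past is already determined.
  have hagree : ∀ y₁ y₂ : Fin T × Fin n → ℕ, (∀ s ∉ A, y₁ s = y₂ s) →
      P.run R (inputOf hT m e y₁) t = P.run R (inputOf hT m e y₂) t := by
    intro y₁ y₂ h12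
    refine P.run_congr R fun u hu => funext fun i => ?_
    unfold inputOf
    rw [h12]
    intro hs
    have h1 : t.val ≤ _ := htime _ hs
    have h2 := source_fst_le (m := m) hT u i
    omega
  have hserver : ∀ y₁ y₂ : Fin T × Fin n → ℕ, (∀ s ∉ A, y₁ s = y₂ s) →
      (conf y₁).server = (conf y₂).server := fun y₁ y₂ h12 => by
    simp only [hconf, Protocol.read, hagree y₁ y₂ h12]
  have hnodes : ∀ y₁ y₂ : Fin T × Fin n → ℕ, (∀ s ∉ A, y₁ s = y₂ s) → ∀ i,
      y₁ (source hT m t i) = y₂ (source hT m t i) → (conf y₁).nodes i = (conf y₂).nodes i :=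
    fun y₁ y₂ h12 i hi => by
      simp only [hconf, Protocol.read, hagree y₁ y₂ h12, inputOf, hi]
  have hnodes' : ∀ y₁ y₂ : Fin T × Fin n → ℕ, (∀ s ∉ A, y₁ s = y₂ s) → ∀ i, i ∉ K →
      (conf y₁).nodes i = (conf y₂).nodes i := fun y₁ y₂ h12 i hi =>
    hnodes y₁ y₂ h12 i (h12 _ fun hs => hi (hKsrc i hs))
  -- Only the item of `s` is inserted; by `firstReply_congr` the other open items do not matter.
  set ρ : Fin T × Fin n → ℕ → ℕ := fun s z =>
    P.firstReply K R (conf (Function.update y s z)) s.2 with hρ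
  have hρ' : ∀ y' ∈ extensions ℓ w A y, ∀ s ∈ earliest A,
      P.firstReply K R (conf y') s.2 = ρ s (y' s) := by
    intro y' hy' s hs
    obtain ⟨hsA, hst⟩ := (hearly s).1 hs
    have h12 : ∀ s' ∉ A, y' s' = Function.update y s (y' s) s' := by
      intro s' hs'
      rw [Function.update_of_ne (fun hss => hs' (by rw [hss]; exact hsA)), hy'.1 s' hs']
    refine P.firstReply_congr K R (hserver _ _ h12) (hnodes' _ _ h12) (hnodes _ _ h12 _ ?_)
    have : source hT m t s.2 = s := by
      rw [← hst]; exact source_of_mem_slots hT (h.subset hsA)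
    rw [this, Function.update_self]
  have hKearly : ∀ i ∈ K, (t, i) ∈ earliest A := fun i hi =>
    (hearly _).2 ⟨by simpa [hK] using hi, rfl⟩
  set out : D := P.output ((P.quietRound K)^[R] (conf y)).server with hout
  -- `v` is the label of the output under silence. If the output has no label, it is never correct
  -- under silence and the default 0 is harmless.
  refine ⟨ρ, if hv : ∃ z < N, e z = out then hv.choose else 0, fun y' hy' => ?_,
    fun y' hy' I hI τ hτ hIτ hj => ?_⟩
  · by_cases hlt : ∃ i ∈ earliest A, ρ i (y' i) < R
    · obtain ⟨i, hi, hi'⟩ := hlt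
      exact ⟨i, hi, Or.inl hi'⟩
    push Not at hlt
    have hquiet : P.round^[R] (conf y') = (P.quietRound K)^[R] (conf y') := by
      refine P.round_iterate_eq_quietRound K _ fun r hr i hi => ?_
      have h1 := hlt _ (hKearly i hi)
      rw [← hρ' y' hy' _ (hKearly i hi)] at h1
      exact P.replies_eq_none_of_lt_firstReply K (lt_of_lt_of_le hr h1)
    obtain ⟨hN', hinj'⟩ := h.extension hy'
    have hleast := hP y' (isInput_inputOf hT hmn he hN' hinj') t t.2
    have hrun : P.run R (inputOf hT m e y') (t + 1) = P.round^[R] (conf y') := rfl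
    rw [hrun, hquiet, (P.quietRound_agree K (hserver y' y hy'.1) (hnodes' y' y hy'.1) R).1]
      at hleast
    obtain ⟨⟨i, hi⟩, hmin⟩ := hleast
    have hsrc := source_mem_slots (m := m) hT t i
    -- The minimum is an open item, since the item of `I₀` is below all fixed ones.
    have hiA : source hT m t i ∈ A := by
      by_contra hiA
      have h1 := h.above _ hsrc hiA
      rw [← hy'.1 _ hiA] at h1
      have h2 := lt_of_mem_cell (hy'.2.2 I₀ hI₀A)
      have h3 := hmin (Set.mem_range_self I₀.2)
      have h4 : inputOf hT m e y' t I₀.2 = e (y' I₀) := by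
        unfold inputOf; rw [source_of_mem_slots hT (h.subset hI₀A)]
      rw [← hi, h4] at h3
      have h5 : e (y' I₀) < e (y' (source hT m t i)) :=
        he (hN' _ (h.subset hI₀A)) (hN' _ hsrc) (lt_of_lt_of_le h2 h1)
      exact absurd h3 (not_le.2 h5)
    have hv : ∃ z < N, e z = out := ⟨y' (source hT m t i), hN' _ hsrc, hi⟩
    have hsrc' : source hT m t i = (t, i) :=
      Prod.ext (le_antisymm (source_fst_le hT t i) (htime _ hiA)) (source_snd hT t i)
    refine ⟨source hT m t i, (hearly _).2 ⟨hiA, by rw [hsrc']⟩, Or.inr ?_⟩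
    rw [dif_pos hv]
    exact he.injOn (hN' _ hsrc) hv.choose_spec.1 (hi.trans hv.choose_spec.2.symm)
  · obtain ⟨hIA, hIt⟩ := (hearly I).1 hI
    rw [← hρ' y' hy' I hI] at hIτ
    -- Before the first reply of `I`, which comes by round `τ`, no node of `K` replies, so ignoring
    -- `K` changes nothing and the reply really occurs.
    have hquiet : P.round^[P.firstReply K R (conf y') I.2] (conf y') =
        (P.quietRound K)^[P.firstReply K R (conf y') I.2] (conf y') := by
      refine P.round_iterate_eq_quietRound K _ fun r hr i hi => ?_
      by_cases hiI : (t, i) = I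
      · rw [← hiI] at hr
        exact P.replies_eq_none_of_lt_firstReply K hr
      · have h1 := hj _ (hKearly i hi) hiI
        rw [← hρ' y' hy' _ (hKearly i hi)] at h1
        change τ ≤ P.firstReply K R (conf y') i at h1
        exact P.replies_eq_none_of_lt_firstReply K (R := R) (by omega)
    have hspk : P.Speaks R (inputOf hT m e y') I.1 I.2 := by
      rw [hIt]
      refine ⟨P.firstReply K R (conf y') I.2, by omega, ?_⟩
      have := P.isSome_replies_firstReply K (R := R) (C := conf y') (i := I.2) (by omega)
      rw [← hquiet] at this
      exact this
    unfold speaks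
    rw [if_pos hspk]

/-! ### Summing over all slots -/

/-- The sum over all time steps of the harmonic number of the number of slots. -/
noncomputable def harmonicSum (A : Finset (Fin T × Fin n)) : ℝ :=
  ∑ t : Fin T, ((harmonic (A.filter fun s => s.1 = t).card : ℚ) : ℝ)

theorem harmonicSum_erase {A : Finset (Fin T × Fin n)} {I : Fin T × Fin n}
    (hI : I ∈ earliest A) :
    harmonicSum A = harmonicSum (A.erase I) + 1 / ((earliest A).card : ℝ) := by
  have hIA := earliest_subset A hI
  unfold harmonicSum
  rw [← Finset.add_sum_erase _ (fun t => ((harmonic (A.filter fun s => s.1 = t).card : ℚ) : ℝ))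
      (Finset.mem_univ I.1),
    ← Finset.add_sum_erase _ (fun t =>
      ((harmonic ((A.erase I).filter fun s => s.1 = t).card : ℚ) : ℝ)) (Finset.mem_univ I.1)]
  have h1 : ∑ t ∈ Finset.univ.erase I.1, ((harmonic (A.filter fun s => s.1 = t).card : ℚ) : ℝ) =
      ∑ t ∈ Finset.univ.erase I.1,
        ((harmonic ((A.erase I).filter fun s => s.1 = t).card : ℚ) : ℝ) := by
    refine Finset.sum_congr rfl fun t ht => ?_
    rw [Finset.filter_erase, Finset.erase_eq_of_notMem]
    simp only [Finset.mem_filter, not_and]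
    exact fun _ h => (Finset.ne_of_mem_erase ht) h.symm
  have h2 : (A.filter fun s => s.1 = I.1).card =
      ((A.erase I).filter fun s => s.1 = I.1).card + 1 := by
    rw [Finset.filter_erase, Finset.card_erase_add_one]
    simp [hIA]
  rw [h1, earliest_eq_filter hI, h2, harmonic_succ]
  push_cast
  ring

/-- Induction on the number of open slots: filling one reduces the harmonic sum by `1 / k`, and
`slot_bound` pays `1 / (8 k)` for it. The spare `p + 1` levels ensure the height that the silence
bound needs. -/
theorem harmonicSum_le_law [LinearOrder D] (hmn : m ≤ n) {N R : ℕ} {e : ℕ → D}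
    (he : StrictMonoOn e (Set.Iio N)) (P : Protocol n D M Q S)
    (hP : ∀ y : Fin T × Fin n → ℕ, IsInput m T (inputOf hT m e y) →
      P.TracksMinOn R T (inputOf hT m e y)) {L U : ℕ → ℕ}
    (hL : ∀ p, 0 < L p) (hU : ∀ p, U (p + 1) = U p + L p)
    (hLU : ∀ p, (U p + 1) * granularity R p ^ 2 ≤ L p) (p : ℕ) :
    ∀ (ℓ w : ℕ) (A : Finset (Fin T × Fin n)) (y : Fin T × Fin n → ℕ), A.card = p →
      U p + (p + 1) ≤ ℓ → PartialInput n m T N ℓ w A y →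
      1 / 8 * harmonicSum A ≤ law earliest L p ℓ w A y
        (fun y' => ∑ s ∈ A, speaks (m := m) hT P R e s y') := by
  induction p with
  | zero =>
    intro ℓ w A y hA _ _
    rw [Finset.card_eq_zero] at hA
    subst hA
    simp [law, harmonicSum]
  | succ p ih =>
    intro ℓ w A y hA hℓ h
    have hAne : A.Nonempty := Finset.card_pos.1 (by omega)
    have hUp := hU p
    obtain ⟨ρ, v, h1, h2⟩ := h.exists_firstReply hT hmn he P hP hAne
    have hslot := slot_bound (earliest_subset (n := n) (T := T)) earliest_nonempty hL hU hA
      (hLU p) (by omega) ρ (fun s y' => speaks (m := m) hT P R e s y')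
      (fun s y' => speaks_nonneg hT P R e s y') h1 h2
    set X : Set ((Fin T × Fin n) × ℕ × ℕ × ℕ) := {x | x.1 ∈ earliest A ∧ x.2.1 < L p ∧
      x.2.2.1 ∈ cell x.2.1 w ∧ x.2.2.2 ∈ cell (ℓ - x.2.1 - 1) (2 * x.2.2.1 + 1)} with hX
    obtain ⟨Φ, hΦ⟩ : ∃ Φ : (((Fin T × Fin n) × ℕ × ℕ × ℕ) → ℝ) → ℝ, Φ = fun F =>
        (∑ I ∈ earliest A, (∑ a ∈ Finset.range (L p),
          halve^[a] (fun W => halve^[ℓ - a - 1] (fun z => F (I, a, W, z)) (2 * W + 1)) w)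
            / (Finset.range (L p)).card) / (earliest A).card := ⟨_, rfl⟩
    have MX : IsMean X Φ := by
      rw [hΦ]
      refine IsMean.average _ (earliest_nonempty A hAne) _ fun I hI => ?_
      refine IsMean.average _ (by simpa using (hL p).ne') _ fun a ha => ?_
      refine IsMean.halve_iterate _ a w fun W hW => ?_
      refine IsMean.halve_iterate _ _ _ fun z hz => ?_
      exact IsMean.dirac ⟨hI, Finset.mem_range.1 ha, hW, hz⟩
    set G : (Fin T × Fin n) × ℕ × ℕ × ℕ → ((Fin T × Fin n → ℕ) → ℝ) → ℝ := fun x =>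
      law earliest L p (ℓ - x.2.1 - 1) (2 * x.2.2.1) (A.erase x.1)
        (Function.update y x.1 x.2.2.2) with hG
    -- For each choice of `I`, height, `W` and `z`, the slots other than `I` are covered by the
    -- induction hypothesis; the message of `I` is paid for only on average over these choices.
    have hmono := MX.mono
      (F := fun x => G x (fun y' => speaks (m := m) hT P R e x.1 y') +
        (1 / 8 * harmonicSum A - 1 / (8 * ((earliest A).card : ℝ))))
      (G := fun x => G x (fun y' => ∑ s ∈ A, speaks (m := m) hT P R e s y')) (by
        rintro ⟨I, a, W, z⟩ ⟨hI, ha, hW, hz⟩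
        simp only at hI ha hW hz
        have hIA := earliest_subset A hI
        have hcard : (A.erase I).card = p := by
          rw [Finset.card_erase_of_mem hIA, hA]; rfl
        have MG := isMean_law (earliest_subset (n := n) (T := T)) earliest_nonempty hL hU p
          (ℓ - a - 1) (2 * W) (A.erase I) (Function.update y I z) hcard (by omega)
        have hih := ih (ℓ - a - 1) (2 * W) (A.erase I) (Function.update y I z) hcard (by omega)
          (h.step (by omega) hW hz)
        have hsplit : (fun y' => ∑ s ∈ A, speaks (m := m) hT P R e s y') =
            fun y' => speaks (m := m) hT P R e I y' +
              ∑ s ∈ A.erase I, speaks (m := m) hT P R e s y' :=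
          funext fun y' => (Finset.add_sum_erase A _ hIA).symm
        simp only [hG]
        rw [hsplit, MG.add]
        have e1 := harmonicSum_erase hI
        have e2 : 1 / (8 * ((earliest A).card : ℝ)) = 1 / 8 * (1 / ((earliest A).card : ℝ)) := by
          rw [one_div_mul_one_div]
        rw [e2]
        linarith)
    rw [MX.add, MX.const] at hmono
    have hlaw : law earliest L (p + 1) ℓ w A y
        (fun y' => ∑ s ∈ A, speaks (m := m) hT P R e s y') =
        Φ (fun x => G x (fun y' => ∑ s ∈ A, speaks (m := m) hT P R e s y')) := by
      rw [hΦ]; rfl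
    have hslot' : 1 / (8 * ((earliest A).card : ℝ)) ≤
        Φ (fun x => G x (fun y' => speaks (m := m) hT P R e x.1 y')) := by
      rw [hΦ]; exact hslot
    rw [hlaw]
    linarith

/-- There are `n` slots at time 0 and `m` at each later time. The factor `1/2` replaces `T - 1` by
`T`, using `log m ≤ log n`. -/
theorem log_le_harmonicSum_slots (hT : 0 < T) (hm : 1 ≤ m) (hmn : m ≤ n) :
    1 / 2 * (Real.log n + T * Real.log m) ≤ harmonicSum (slots n m T) := by
  have hlog : ∀ k : ℕ, 1 ≤ k → Real.log k ≤ ((harmonic k : ℚ) : ℝ) := fun k hk =>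
    (Real.log_le_log (by exact_mod_cast hk) (by push_cast; linarith)).trans
      (log_add_one_le_harmonic k)
  have hcard : ∀ t : Fin T, ((slots n m T).filter fun s => s.1 = t).card =
      if t.val = 0 then n else m := by
    intro t
    have : (slots n m T).filter (fun s => s.1 = t) =
        (Finset.univ.filter fun i : Fin n => t.val = 0 ∨ i.val < m).map
          ⟨fun i => (t, i), fun i j h => (Prod.mk.inj h).2⟩ := by
      ext ⟨u, i⟩
      simp only [slots, Finset.mem_filter, Finset.mem_univ, true_and, Finset.mem_map]
      constructor
      · rintro ⟨h, rfl⟩; exact ⟨i, h, rfl⟩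
      · rintro ⟨j, h, hj⟩
        obtain ⟨rfl, rfl⟩ := Prod.mk.inj hj
        exact ⟨h, rfl⟩
    rw [this, Finset.card_map]
    split_ifs with ht
    · simp [ht]
    · simp only [ht, false_or]
      rw [Fin.card_filter_val_lt, min_eq_right hmn]
  have hn0 : 0 ≤ Real.log n := Real.log_natCast_nonneg n
  have hm0 : 0 ≤ Real.log m := Real.log_natCast_nonneg m
  have hmn' : Real.log m ≤ Real.log n :=
    Real.log_le_log (by exact_mod_cast hm) (by exact_mod_cast hmn)
  obtain ⟨T', rfl⟩ : ∃ T', T = T' + 1 := ⟨T - 1, by omega⟩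
  unfold harmonicSum
  simp only [hcard]
  rw [Fin.sum_univ_succ]
  simp only [Fin.val_zero, if_true, Fin.val_succ, Nat.succ_ne_zero, if_false,
    Finset.sum_const, Finset.card_univ, Fintype.card_fin, nsmul_eq_mul]
  have h1 := hlog n (hm.trans hmn)
  have h2 := mul_le_mul_of_nonneg_left (hlog m hm) (Nat.cast_nonneg (α := ℝ) T')
  have h3 : 0 ≤ (T' : ℝ) * Real.log m := by positivity
  push_cast
  linarith

end Deterministic

/-! ### Randomized algorithms -/

/-- The number of levels that `law` uses for `p` elements. -/
def levels (R : ℕ) : ℕ → ℕ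
  | 0 => 0
  | p + 1 => levels R p + (levels R p + 1) * granularity R p ^ 2

theorem exists_strictMonoOn_of_le_card {D : Type*} [LinearOrder D] {N : ℕ} (hN : 0 < N)
    (h : (N : ℕ∞) ≤ ENat.card D) : ∃ e : ℕ → D, StrictMonoOn e (Set.Iio N) := by
  obtain ⟨s, -, hs⟩ := Set.exists_subset_encard_eq (s := (Set.univ : Set D)) (k := N)
    (by rwa [Set.encard_univ])
  have hfin : s.Finite := Set.finite_of_encard_eq_coe hs
  have hcard : hfin.toFinset.card = N := by
    rw [hfin.encard_eq_coe_toFinset_card] at hs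
    exact_mod_cast hs
  refine ⟨fun z => hfin.toFinset.orderEmbOfFin hcard ⟨z % N, Nat.mod_lt _ hN⟩, ?_⟩
  intro a ha b hb hab
  refine (hfin.toFinset.orderEmbOfFin hcard).strictMono ?_
  rw [Fin.mk_lt_mk, Nat.mod_eq_of_lt ha, Nat.mod_eq_of_lt hb]
  exact hab

end DistMonitoring

open DistMonitoring in
theorem mainTheorem11 :
    ∃ c : ℝ, 0 < c ∧ ∀ n m T R : ℕ, 1 ≤ m → m ≤ n → 1 ≤ T →
      ∃ N : ℕ, ∀ (D : Type*) [LinearOrder D], (N : ℕ∞) ≤ ENat.card D →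
        ∀ (M Q S Ω : Type*) [MeasurableSpace Ω] (μ : MeasureTheory.Measure Ω)
          [MeasureTheory.IsProbabilityMeasure μ]
          (A : Ω → DistMonitoring.Protocol n D M Q S),
          (∀ x : ℕ → Fin n → D, DistMonitoring.IsInput m T x →
            Measurable fun ω => ((A ω).run R x T).messages) →
          (∀ x : ℕ → Fin n → D, DistMonitoring.IsInput m T x →
            ∀ᵐ ω ∂μ, (A ω).TracksMinOn R T x) →
          ∃ x : ℕ → Fin n → D, DistMonitoring.IsInput m T x ∧
            c * (Real.log n + T * Real.log m) ≤
              ∫ ω, (((A ω).run R x T).messages : ℝ) ∂μ := by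
  classical
  -- `1/8` from each slot times `1/2` from `log_le_harmonicSum_slots`.
  refine ⟨1 / 16, by norm_num, fun n m T R hm hmn hT => ?_⟩
  set B : Finset (Fin T × Fin n) := slots n m T with hB
  set ℓ : ℕ := levels R B.card + (B.card + 1) with hℓ
  refine ⟨2 ^ ℓ, fun D _ hD M Q S Ω _ μ _ A hmeas hA => ?_⟩
  obtain ⟨e, he⟩ := exists_strictMonoOn_of_le_card (by positivity) hD
  set U := levels R with hU
  set L : ℕ → ℕ := fun p => (U p + 1) * granularity R p ^ 2 with hL
  have hUL : ∀ p, U (p + 1) = U p + L p := fun p => rfl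
  have hL0 : ∀ p, 0 < L p := fun p => by
    simp only [hL, granularity]; positivity
  have hpart : PartialInput n m T (2 ^ ℓ) ℓ 0 B 0 :=
    ⟨subset_rfl, fun s hs hs' => absurd hs hs', fun s hs hs' => absurd hs hs',
      fun s hs hs' => absurd hs hs', by simp⟩
  have hmean := isMean_law (earliest_subset (n := n) (T := T)) earliest_nonempty hL0 hUL B.card
    ℓ 0 B 0 rfl (by omega)
  have hin : ∀ y ∈ extensions ℓ 0 B 0, IsInput m T (inputOf hT m e y) := fun y hy =>
    isInput_inputOf hT hmn he (hpart.extension hy).1 (hpart.extension hy).2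
  -- Measurability is known for valid inputs only, so the cost is set to 0 elsewhere.
  set f : (Fin T × Fin n → ℕ) → Ω → ℝ := fun y ω =>
    if IsInput m T (inputOf hT m e y) then (((A ω).run R (inputOf hT m e y) T).messages : ℝ)
      else 0 with hf
  have hint : ∀ y, MeasureTheory.Integrable (f y) μ := by
    intro y
    by_cases hy : IsInput m T (inputOf hT m e y)
    · simp only [hf, hy, if_true]
      refine MeasureTheory.Integrable.of_bound
        ((measurable_from_top (f := fun k : ℕ => (k : ℝ))).comp
          (hmeas _ hy)).aestronglyMeasurable (T * (R * (1 + n + n)) : ℕ)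
        (Filter.Eventually.of_forall fun ω => ?_)
      rw [Real.norm_of_nonneg (Nat.cast_nonneg _)]
      exact Nat.cast_le.2 ((A ω).messages_le R _ T)
    · simp only [hf, hy, if_false]
      exact MeasureTheory.integrable_zero _ _ _
  obtain ⟨hint', hswap⟩ := hmean.integral μ f hint
  -- There are countably many `y`, so one null set serves all inputs and almost every `A ω` is a
  -- correct deterministic protocol.
  have hae : ∀ᵐ ω ∂μ, ∀ y : Fin T × Fin n → ℕ, IsInput m T (inputOf hT m e y) →
      (A ω).TracksMinOn R T (inputOf hT m e y) := by
    rw [MeasureTheory.ae_all_iff]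
    intro y
    by_cases hy : IsInput m T (inputOf hT m e y)
    · filter_upwards [hA _ hy] with ω hω _ using hω
    · exact Filter.Eventually.of_forall fun ω h => absurd h hy
  have hlow : ∀ᵐ ω ∂μ, 1 / 16 * (Real.log n + T * Real.log m) ≤
      law earliest L B.card ℓ 0 B 0 (fun y => f y ω) := by
    filter_upwards [hae] with ω hω
    have h1 := harmonicSum_le_law hT hmn he (A ω) hω hL0 hUL (fun p => le_rfl) B.card ℓ 0 B 0
      rfl le_rfl hpart
    have h2 := log_le_harmonicSum_slots hT hm hmn
    have h3 := hmean.mono (F := fun y' => ∑ s ∈ B, speaks (m := m) hT (A ω) R e s y')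
      (G := fun y => f y ω) fun y hy => by
        simp only [hf, hin y hy, if_true]
        exact sum_speaks_le hT (A ω) R e y B
    linarith
  have hge : 1 / 16 * (Real.log n + T * Real.log m) ≤
      law earliest L B.card ℓ 0 B 0 (fun y => ∫ ω, f y ω ∂μ) := by
    rw [hswap]
    have := MeasureTheory.integral_mono_ae (MeasureTheory.integrable_const _) hint' hlow
    simpa using this
  -- Some input costs at least the average.
  obtain ⟨y, hy, hle⟩ := hmean.exists_le (fun y => ∫ ω, f y ω ∂μ)
  refine ⟨inputOf hT m e y, hin y hy, hge.trans (hle.trans (le_of_eq ?_))⟩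
  simp only [hf, hin y hy, if_true]
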